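/- Let $(\mathcal C,\mathbb E,\mathfrak s)$ be an extriangulated category: $\mathcal C$ is an additive category, $\mathbb E\colon \mathcal C^{\mathrm{op}}\times\mathcal C\to \mathrm{Ab}$ is a biadditive functor and $\mathfrak s$ is its realization. An $\mathfrak s$-triangle $A\xrightarrow{x}B\xrightarrow{y}C\overset{\delta}{\dashrightarrow}$ is a sequence with an extension $\delta\in\mathbb E(C,A)$ such that $\mathfrak s(\delta)=[A\xrightarrow{x}B\xrightarrow{y}C]$; then $A\xrightarrow{x}B\xrightarrow{y}C$ is called an $\mathfrak s$-conflation, $x$ an $\mathfrak s$-inflation with cone $C$, and $y$ an $\mathfrak s$-deflation with cocone $A$. Write $a_*\delta=\mathbb E(C,a)(\delta)$ and $c^*\delta=\mathbb E(c,A)(\delta)$. Let $\mathcal N\subseteq\mathcal C$ be a biresolving thick subcategory. That is, $\mathcal N$ is a full additive subcategory, closed under isomorphisms and direct summands; whenever two of the three terms of an $\mathfrak s$-conflation lie in $\mathcal N$, so does the third; and every object $X\in\mathcal C$ admits an $\mathfrak s$-inflation $X\to N$ and an $\mathfrak s$-deflation $N'\to X$ with $N,N'\in\mathcal N$. Let $\mathcal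 L$ be the class of $\mathfrak s$-inflations with cone in $\mathcal N$, let $\mathcal R$ be the class of $\mathfrak s$-deflations with cocone in $\mathcal N$, and let $\mathcal S=\mathcal S_{\mathcal N}$ be the smallest class of morphisms closed under composition and containing $\mathcal L\cup\mathcal R$. Let $\mathcal N_{\mathcal S}$ be the full subcategory of the objects $X$ such that both $X\to0$ and $0\to X$ belong to $\mathcal S$, let $p\colon\mathcal C\to\overline{\mathcal C}=\mathcal C/[\mathcal N_{\mathcal S}]$, $f\mapsto\overline f$, be the ideal quotient, and let $\overline{\mathcal S}$ be the closure of $p(\mathcal S)$ under composition with isomorphisms of $\overline{\mathcal C}$. Then $\mathcal N_{\mathcal S}=\mathcal N$, so that $\overline{\mathcal C}=\mathcal C/[\mathcal N]$, and the following hold. - (MR1) $\overline{\mathcal S}$ satisfies two-out-of-three with respect to composition in $\overline{\mathcal C}$. - (MR2) $\overline{\mathcal S}$ is a (two-sided) multiplicative system in $\overline{\mathcal C}$. - (MR3) Let $A\xrightarrow{x}B\xrightarrow{y}C\overset{\delta}{\dashrightarrow}$ and $A'\xrightarrow{x'}B'\xrightarrow{y'}C'\overset{\delta'}{\dashrightarrow}$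 be $\mathfrak s$-triangles, and let $a\colon A\to A'$ and $c\colon C\to C'$ satisfy $a_*\delta=c^*\delta'$. If $\overline a,\overline c\in\overline{\mathcal S}$, then there is $\mathbf b\in\overline{\mathcal S}(B,B')$ with $\mathbf b\circ\overline x=\overline{x'}\circ\overline a$ and $\overline c\circ\overline y=\overline{y'}\circ\mathbf b$. - (MR4) The class $\{\mathbf v\circ\overline x\circ\mathbf u\mid x \text{ an } \mathfrak s\text{-inflation},\ \mathbf u,\mathbf v\in\overline{\mathcal S}\}$ is closed under composition in $\overline{\mathcal C}$, and so is the class $\{\mathbf v\circ\overline y\circ\mathbf u\mid y \text{ an } \mathfrak s\text{-deflation},\ \mathbf u,\mathbf v\in\overline{\mathcal S}\}$. Moreover, $\overline{\mathcal S}$ is exactly the class of morphisms of $\overline{\mathcal C}$ that are both monomorphic and epimorphic. -/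

import Mathlib

open CategoryTheory CategoryTheory.Limits Opposite ZeroObject

universe v u w

namespace Extri

variable {C : Type u} [Category.{v} C]

/-- A sequence `A ⟶ B ⟶ C` with fixed end terms. -/
structure Seq (A D : C) where
  /-- the middle term -/
  mid : C
  /-- the first morphism -/
  ι : A ⟶ mid
  /-- the second morphism -/
  π : mid ⟶ D

/-- Two sequences with the same end terms are equivalent if there is an isomorphism between the
middle terms which is compatible with the identities of the end terms. -/
def Seq.Equiv {A D : C} (s t : Seq A D) : Prop :=
  ∃ b : s.mid ≅ t.mid, s.ι ≫ b.hom = t.ι ∧ b.hom ≫ t.π = s.π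

/-- Equivalence of sequences is an equivalence relation. -/
instance seqSetoid (A D : C) : Setoid (Seq A D) where
  r := Seq.Equiv
  iseqv :=
    { refl := fun s => ⟨Iso.refl _, by simp, by simp⟩
      symm := by
        rintro s t ⟨b, h₁, h₂⟩
        exact ⟨b.symm, by simp [← h₁], by simp [← h₂]⟩
      trans := by
        rintro r s t ⟨b, h₁, h₂⟩ ⟨b', h₁', h₂'⟩
        refine ⟨b ≪≫ b', ?_, ?_⟩
        · simp only [Iso.trans_hom]
          rw [← Category.assoc, h₁, h₁']
        · simp only [Iso.trans_hom]
          rw [Category.assoc, h₂', h₂] }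

variable (C) in
/-- The data of a triplet `(C, 𝔼, 𝔰)`: a biadditive functor `𝔼 : Cᵒᵖ × C ⥤ Ab` and a map `𝔰`
sending each extension `δ ∈ 𝔼(D, A)` to an equivalence class of sequences `A ⟶ B ⟶ D`. -/
structure Data [Preadditive C] where
  /-- the functor of extensions, contravariant in the first and covariant in the second variable -/
  E : Cᵒᵖ ⥤ C ⥤ AddCommGrpCat.{w}
  /-- additivity in the first variable -/
  additive_fst : E.Additive
  /-- additivity in the second variable -/
  additive_snd : ∀ X : Cᵒᵖ, (E.obj X).Additive
  /-- the assignment of an equivalence class of sequences to each extension -/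
  real : ∀ {A D : C}, (E.obj (op D)).obj A → Quotient (seqSetoid A D)

namespace Data

section

variable [Preadditive C] (𝒞 : Data.{v, u, w} C)

/-- The group `𝔼(D, A)` of extensions. -/
abbrev Ext (D A : C) : Type w := (𝒞.E.obj (op D)).obj A

/-- `a_* δ = 𝔼(D, a)(δ)`. -/
def push {A A' D : C} (a : A ⟶ A') (δ : 𝒞.Ext D A) : 𝒞.Ext D A' :=
  (𝒞.E.obj (op D)).map a δ

/-- `c^* δ = 𝔼(c, A)(δ)`. -/
def pull {A D D' : C} (c : D' ⟶ D) (δ : 𝒞.Ext D A) : 𝒞.Ext D' A :=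
  (𝒞.E.map c.op).app A δ

/-- `A -x⟶ B -y⟶ D` together with `δ` is an `𝔰`-triangle. -/
def IsTriangle {A B D : C} (x : A ⟶ B) (y : B ⟶ D) (δ : 𝒞.Ext D A) : Prop :=
  𝒞.real δ = Quotient.mk (seqSetoid A D) ⟨B, x, y⟩

/-- `A -x⟶ B -y⟶ D` is an `𝔰`-conflation. -/
def IsConflation {A B D : C} (x : A ⟶ B) (y : B ⟶ D) : Prop :=
  ∃ δ : 𝒞.Ext D A, 𝒞.IsTriangle x y δ

/-- The class of `𝔰`-inflations. -/
def inflations : MorphismProperty C := fun _ _ x => ∃ (D : C) (y : _ ⟶ D), 𝒞.IsConflation x y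

/-- The class of `𝔰`-deflations. -/
def deflations : MorphismProperty C := fun _ _ y => ∃ (A : C) (x : A ⟶ _), 𝒞.IsConflation x y

end

variable [Preadditive C] [HasZeroObject C] [HasBinaryBiproducts C]

/-- The triplet `(C, 𝔼, 𝔰)` is a weakly extriangulated category. -/
structure IsWeaklyExtriangulated (𝒞 : Data.{v, u, w} C) : Prop where
  /-- exactness of `C(X, A) ⟶ C(X, B) ⟶ C(X, D)` -/
  exact_hom_from_mid : ∀ {A B D : C} {x : A ⟶ B} {y : B ⟶ D} {δ : 𝒞.Ext D A},
    𝒞.IsTriangle x y δ → ∀ X : C,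
      Function.Exact (fun g : X ⟶ A => g ≫ x) (fun g : X ⟶ B => g ≫ y)
  /-- exactness of `C(X, B) ⟶ C(X, D) ⟶ 𝔼(X, A)` -/
  exact_hom_from_right : ∀ {A B D : C} {x : A ⟶ B} {y : B ⟶ D} {δ : 𝒞.Ext D A},
    𝒞.IsTriangle x y δ → ∀ X : C,
      Function.Exact (fun g : X ⟶ B => g ≫ y) (fun g : X ⟶ D => 𝒞.pull g δ)
  /-- exactness of `C(D, X) ⟶ C(B, X) ⟶ C(A, X)` -/
  exact_hom_to_mid : ∀ {A B D : C} {x : A ⟶ B} {y : B ⟶ D} {δ : 𝒞.Ext D A},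
    𝒞.IsTriangle x y δ → ∀ X : C,
      Function.Exact (fun g : D ⟶ X => y ≫ g) (fun g : B ⟶ X => x ≫ g)
  /-- exactness of `C(B, X) ⟶ C(A, X) ⟶ 𝔼(D, X)` -/
  exact_hom_to_left : ∀ {A B D : C} {x : A ⟶ B} {y : B ⟶ D} {δ : 𝒞.Ext D A},
    𝒞.IsTriangle x y δ → ∀ X : C,
      Function.Exact (fun g : B ⟶ X => x ≫ g) (fun g : A ⟶ X => 𝒞.push g δ)
  /-- `0 ∈ 𝔼(0, A)` is realized by `A = A ⟶ 0` -/
  triangle_id_zero : ∀ A : C, 𝒞.IsTriangle (𝟙 A) (0 : A ⟶ (0 : C)) 0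
  /-- `0 ∈ 𝔼(A, 0)` is realized by `0 ⟶ A = A` -/
  triangle_zero_id : ∀ A : C, 𝒞.IsTriangle (0 : (0 : C) ⟶ A) (𝟙 A) 0
  /-- a morphism of `𝔰`-triangles `(a, b, 𝟙)` from `δ` to `a_* δ` whose mapping cone is an
  `𝔰`-triangle -/
  exists_good_lift_push : ∀ {A B D A' B' : C} {x : A ⟶ B} {y : B ⟶ D} {δ : 𝒞.Ext D A}
    (a : A ⟶ A') {x' : A' ⟶ B'} {y' : B' ⟶ D},
    𝒞.IsTriangle x y δ → 𝒞.IsTriangle x' y' (𝒞.push a δ) →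
      ∃ b : B ⟶ B', x ≫ b = a ≫ x' ∧ b ≫ y' = y ∧
        𝒞.IsTriangle (biprod.lift x a) (biprod.desc b (-x')) (𝒞.pull y' δ)
  /-- a morphism of `𝔰`-triangles `(𝟙, b, c)` from `c^* δ` to `δ` whose mapping cocone is an
  `𝔰`-triangle -/
  exists_good_lift_pull : ∀ {A B D B' D' : C} {x : A ⟶ B} {y : B ⟶ D} {δ : 𝒞.Ext D A}
    (c : D' ⟶ D) {x' : A ⟶ B'} {y' : B' ⟶ D'},
    𝒞.IsTriangle x y δ → 𝒞.IsTriangle x' y' (𝒞.pull c δ) →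
      ∃ b : B' ⟶ B, x' ≫ b = x ∧ b ≫ y = y' ≫ c ∧
        𝒞.IsTriangle (biprod.lift (-y') b) (biprod.desc c y) (𝒞.push x' δ)

/-- The triplet `(C, 𝔼, 𝔰)` is an extriangulated category. -/
structure IsExtriangulated (𝒞 : Data.{v, u, w} C) : Prop extends
    𝒞.IsWeaklyExtriangulated where
  /-- inflations are closed under composition -/
  inflations_comp : 𝒞.inflations.IsStableUnderComposition
  /-- deflations are closed under composition -/
  deflations_comp : 𝒞.deflations.IsStableUnderComposition

/-- The full subcategory given by `N` is a thick subcategory: it is additive, closed under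
isomorphisms and direct summands, and has the two-out-of-three property for conflations. -/
structure IsThick (𝒞 : Data.{v, u, w} C) (N : ObjectProperty C) : Prop where
  zero_mem : N (0 : C)
  biprod_mem : ∀ {X Y : C}, N X → N Y → N (X ⊞ Y)
  of_iso : ∀ {X Y : C}, (X ≅ Y) → N X → N Y
  of_biprod_left : ∀ {X Y : C}, N (X ⊞ Y) → N X
  of_biprod_right : ∀ {X Y : C}, N (X ⊞ Y) → N Y
  mem_right : ∀ {A B D : C} {x : A ⟶ B} {y : B ⟶ D}, 𝒞.IsConflation x y → N A → N B → N D
  mem_mid : ∀ {A B D : C} {x : A ⟶ B} {y : B ⟶ D}, 𝒞.IsConflation x y → N A → N D → N B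
  mem_left : ∀ {A B D : C} {x : A ⟶ B} {y : B ⟶ D}, 𝒞.IsConflation x y → N B → N D → N A

/-- A thick subcategory is biresolving if each object admits an inflation to, and a deflation
from, an object of the subcategory. -/
structure IsBiresolvingThick (𝒞 : Data.{v, u, w} C) (N : ObjectProperty C) : Prop extends
    𝒞.IsThick N where
  exists_inflation : ∀ X : C, ∃ (M : C) (i : X ⟶ M), N M ∧ 𝒞.inflations i
  exists_deflation : ∀ X : C, ∃ (M : C) (j : M ⟶ X), N M ∧ 𝒞.deflations j

end Data

/-- The class `ℒ` of inflations with cone in `N`. -/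
def classL [Preadditive C] (𝒞 : Data.{v, u, w} C) (N : ObjectProperty C) :
    MorphismProperty C :=
  fun _ _ f => ∃ (D : C) (y : _ ⟶ D), 𝒞.IsConflation f y ∧ N D

/-- The class `ℛ` of deflations with cocone in `N`. -/
def classR [Preadditive C] (𝒞 : Data.{v, u, w} C) (N : ObjectProperty C) :
    MorphismProperty C :=
  fun _ _ f => ∃ (A : C) (x : A ⟶ _), 𝒞.IsConflation x f ∧ N A

/-- The class `𝒮_N`: the smallest class of morphisms which contains `ℒ` and `ℛ` and is closed
under composition. -/
inductive classS [Preadditive C] (𝒞 : Data.{v, u, w} C) (N : ObjectProperty C) :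
    MorphismProperty C
  | of_L {X Y : C} (f : X ⟶ Y) (hf : classL 𝒞 N f) : classS 𝒞 N f
  | of_R {X Y : C} (f : X ⟶ Y) (hf : classR 𝒞 N f) : classS 𝒞 N f
  | comp {X Y Z : C} (f : X ⟶ Y) (g : Y ⟶ Z) (hf : classS 𝒞 N f) (hg : classS 𝒞 N g) :
      classS 𝒞 N (f ≫ g)

/-- The objects `X` such that both `X ⟶ 0` and `0 ⟶ X` belong to the class `S`. -/
def nullObjects [Preadditive C] [HasZeroObject C] (S : MorphismProperty C) : ObjectProperty C :=
  fun X => S (0 : X ⟶ (0 : C)) ∧ S (0 : (0 : C) ⟶ X)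

/-- Two parallel morphisms are related if their difference factors through an object of `N`. -/
def idealRel [Preadditive C] (N : ObjectProperty C) : HomRel C :=
  fun X Y f g => ∃ (M : C) (i : X ⟶ M) (j : M ⟶ Y), N M ∧ f - g = i ≫ j

/-- The ideal quotient `C/[N]`. -/
abbrev IdealQuotient [Preadditive C] (N : ObjectProperty C) : Type u :=
  CategoryTheory.Quotient (idealRel N)

/-- The projection `C ⥤ C/[N]`. -/
abbrev proj [Preadditive C] (N : ObjectProperty C) : C ⥤ IdealQuotient N :=
  CategoryTheory.Quotient.functor (idealRel N)

variable [Preadditive C] [HasZeroObject C]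

/-- `C̄ = C/[N_S]` for a class of morphisms `S`. -/
abbrev Bar (S : MorphismProperty C) : Type u := IdealQuotient (nullObjects S)

/-- The projection `p : C ⥤ C̄`. -/
abbrev barProj (S : MorphismProperty C) : C ⥤ Bar S := proj (nullObjects S)

/-- The closure `S̄` of `p(S)` under composition with isomorphisms of `C̄`. -/
abbrev barClass (S : MorphismProperty C) : MorphismProperty (Bar S) := S.map (barProj S)

/-- The class of morphisms `v ∘ p(x) ∘ u` with `x ∈ T` and `u, v ∈ S̄`. -/
def barSandwich (S T : MorphismProperty C) : MorphismProperty (Bar S) :=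
  fun X Y f => ∃ (A B : C) (x : A ⟶ B) (u : X ⟶ (barProj S).obj A) (v : (barProj S).obj B ⟶ Y),
    T x ∧ barClass S u ∧ barClass S v ∧ f = u ≫ (barProj S).map x ≫ v

/-- (MR1): `S̄` satisfies two-out-of-three with respect to composition. -/
def MR1 (S : MorphismProperty C) : Prop := (barClass S).HasTwoOutOfThreeProperty

/-- (MR2): `S̄` is a (two-sided) multiplicative system. -/
def MR2 (S : MorphismProperty C) : Prop :=
  (barClass S).HasLeftCalculusOfFractions ∧ (barClass S).HasRightCalculusOfFractions

/-- (MR3): morphisms of extensions with both components in `S̄` lift, in `C̄`, to the middle terms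
of `𝔰`-triangles by a morphism in `S̄`. -/
def MR3 (𝒞 : Data.{v, u, w} C) (S : MorphismProperty C) : Prop :=
  ∀ {A B D A' B' D' : C} {x : A ⟶ B} {y : B ⟶ D} {δ : 𝒞.Ext D A}
    {x' : A' ⟶ B'} {y' : B' ⟶ D'} {δ' : 𝒞.Ext D' A'} (a : A ⟶ A') (c : D ⟶ D'),
    𝒞.IsTriangle x y δ → 𝒞.IsTriangle x' y' δ' → 𝒞.push a δ = 𝒞.pull c δ' →
    barClass S ((barProj S).map a) → barClass S ((barProj S).map c) →
      ∃ b : (barProj S).obj B ⟶ (barProj S).obj B', barClass S b ∧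
        (barProj S).map x ≫ b = (barProj S).map a ≫ (barProj S).map x' ∧
        (barProj S).map y ≫ (barProj S).map c = b ≫ (barProj S).map y'

/-- (MR4): the classes `{v ∘ p(x) ∘ u}` with `u, v ∈ S̄` and `x` an inflation, respectively a
deflation, are closed under composition. -/
def MR4 (𝒞 : Data.{v, u, w} C) (S : MorphismProperty C) : Prop :=
  (barSandwich S 𝒞.inflations).IsStableUnderComposition ∧
    (barSandwich S 𝒞.deflations).IsStableUnderComposition

end Extri

/-! The whole statement rests on one description: a morphism lies in `𝒮` iff it is monic and epic
modulo the ideal `[N]` (`classS_iff`). For `f ∈ ℒ`, good lifts of pushforwards give exact sequences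
through which any morphism killed by `f` modulo `N` factors through an object of `N`
(`classL.epiMod`, `classL.monoMod`). The case of `ℛ` is dual, and both properties survive
composition.

Conversely, let `f : X ⟶ Y` be monic and epic modulo `N`. Adding a deflation `M ⟶ Y` with `M` in `N`
makes `f` a deflation. Its kernel map factors through `N` because `f` is monic modulo `N`. Pushing
the extension out to an object of `N` then writes `f` as `X ⟶ X ⊞ M ⟶ B ⟶ Y`, where the last map is
in `ℛ` and the middle one is a split inflation with some cone `L`. That `f` is epic modulo `N`
forces `L` into `N` (`classS_of_monoMod_of_epiMod`).

Hence `𝒮̄` is the class of monic and epic morphisms of the quotient, and `p(f) ∈ 𝒮̄` iff `f ∈ 𝒮`.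
Each axiom thus reduces to a statement in `C`: squares commuting modulo `N`
(`classS.exists_left_square`) give MR1 and MR2, lifting `𝒮` to middle terms (`classS.exists_lift`)
gives MR3, and exchanging inflations with `𝒮` (`classS.exists_inflation_comp`) gives MR4. The axioms
are self-dual, so only one half of each argument is carried out. -/

namespace Extri

variable {C : Type u} [Category.{v} C]

namespace Data

/-! ### Functoriality of `𝔼` and realizations -/

section Functoriality

variable [Preadditive C] {𝒞 : Data.{v, u, w} C}

lemma push_id {A D : C} (δ : 𝒞.Ext D A) : 𝒞.push (𝟙 A) δ = δ := by simp [push]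

lemma pull_id {A D : C} (δ : 𝒞.Ext D A) : 𝒞.pull (𝟙 D) δ = δ := by simp [pull]

lemma push_comp {A A' A'' D : C} (a : A ⟶ A') (a' : A' ⟶ A'') (δ : 𝒞.Ext D A) :
    𝒞.push (a ≫ a') δ = 𝒞.push a' (𝒞.push a δ) := by simp [push]

lemma pull_comp {A D D' D'' : C} (c' : D'' ⟶ D') (c : D' ⟶ D) (δ : 𝒞.Ext D A) :
    𝒞.pull (c' ≫ c) δ = 𝒞.pull c' (𝒞.pull c δ) := by simp [pull]

lemma push_pull {A A' D D' : C} (a : A ⟶ A') (c : D' ⟶ D) (δ : 𝒞.Ext D A) :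
    𝒞.push a (𝒞.pull c δ) = 𝒞.pull c (𝒞.push a δ) := by
  simp only [push, pull]
  rw [← ConcreteCategory.comp_apply, ← ConcreteCategory.comp_apply, NatTrans.naturality]

@[simp]
lemma push_zero {A A' D : C} (a : A ⟶ A') : 𝒞.push a (0 : 𝒞.Ext D A) = 0 := map_zero _

@[simp]
lemma pull_zero {A D D' : C} (c : D' ⟶ D) : 𝒞.pull c (0 : 𝒞.Ext D A) = 0 := map_zero _

lemma push_add {A A' D : C} (a : A ⟶ A') (δ δ' : 𝒞.Ext D A) :
    𝒞.push a (δ + δ') = 𝒞.push a δ + 𝒞.push a δ' := map_add _ _ _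

lemma pull_add {A D D' : C} (c : D' ⟶ D) (δ δ' : 𝒞.Ext D A) :
    𝒞.pull c (δ + δ') = 𝒞.pull c δ + 𝒞.pull c δ' := map_add _ _ _

lemma add_push {A A' D : C} (a a' : A ⟶ A') (δ : 𝒞.Ext D A) :
    𝒞.push (a + a') δ = 𝒞.push a δ + 𝒞.push a' δ := by
  have := 𝒞.additive_snd (op D)
  simp [push, Functor.map_add]

lemma add_pull {A D D' : C} (c c' : D' ⟶ D) (δ : 𝒞.Ext D A) :
    𝒞.pull (c + c') δ = 𝒞.pull c δ + 𝒞.pull c' δ := by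
  have := 𝒞.additive_fst
  simp [pull, Functor.map_add]

@[simp]
lemma zero_pull {A D D' : C} (δ : 𝒞.Ext D A) : 𝒞.pull (0 : D' ⟶ D) δ = 0 := by
  have := add_pull (0 : D' ⟶ D) 0 δ
  simpa using this

lemma neg_pull {A D D' : C} (c : D' ⟶ D) (δ : 𝒞.Ext D A) :
    𝒞.pull (-c) δ = -𝒞.pull c δ := by
  have := add_pull c (-c) δ
  rw [add_neg_cancel, zero_pull] at this
  exact eq_neg_of_add_eq_zero_right this.symm

lemma exists_triangle {A D : C} (δ : 𝒞.Ext D A) :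
    ∃ (B : C) (x : A ⟶ B) (y : B ⟶ D), 𝒞.IsTriangle x y δ := by
  obtain ⟨⟨B, x, y⟩, h⟩ := Quotient.exists_rep (𝒞.real δ)
  exact ⟨B, x, y, h.symm⟩

lemma IsTriangle.of_iso {A B B' D : C} {x : A ⟶ B} {y : B ⟶ D} {δ : 𝒞.Ext D A}
    (h : 𝒞.IsTriangle x y δ) (e : B ≅ B') {x' : A ⟶ B'} {y' : B' ⟶ D}
    (hx : x ≫ e.hom = x') (hy : e.hom ≫ y' = y) : 𝒞.IsTriangle x' y' δ :=
  Eq.trans h (Quotient.sound ⟨e, hx, hy⟩)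

lemma IsTriangle.exists_iso {A B B' D : C} {x : A ⟶ B} {y : B ⟶ D} {δ : 𝒞.Ext D A}
    (h : 𝒞.IsTriangle x y δ) {x' : A ⟶ B'} {y' : B' ⟶ D} (h' : 𝒞.IsTriangle x' y' δ) :
    ∃ e : B ≅ B', x ≫ e.hom = x' ∧ e.hom ≫ y' = y :=
  Quotient.exact (Eq.trans (Eq.symm h) h')

end Functoriality

/-! ### Split triangles, uniqueness of cones, good lifts -/

section Exactness

variable [Preadditive C] [HasZeroObject C] [HasBinaryBiproducts C] {𝒞 : Data.{v, u, w} C}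

namespace IsTriangle

variable {A B D : C} {x : A ⟶ B} {y : B ⟶ D} {δ : 𝒞.Ext D A}

lemma comp_eq_zero (h𝒞 : 𝒞.IsWeaklyExtriangulated) (h : 𝒞.IsTriangle x y δ) : x ≫ y = 0 :=
  (h𝒞.exact_hom_from_mid h A _).2 ⟨𝟙 A, by simp⟩

lemma push_ι (h𝒞 : 𝒞.IsWeaklyExtriangulated) (h : 𝒞.IsTriangle x y δ) : 𝒞.push x δ = 0 :=
  (h𝒞.exact_hom_to_left h B _).2 ⟨𝟙 B, by simp⟩

lemma pull_π (h𝒞 : 𝒞.IsWeaklyExtriangulated) (h : 𝒞.IsTriangle x y δ) : 𝒞.pull y δ = 0 :=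
  (h𝒞.exact_hom_from_right h B _).2 ⟨𝟙 B, by simp⟩

lemma exists_lift (h𝒞 : 𝒞.IsWeaklyExtriangulated) (h : 𝒞.IsTriangle x y δ) {X : C} (f : X ⟶ B)
    (hf : f ≫ y = 0) : ∃ g : X ⟶ A, g ≫ x = f :=
  (h𝒞.exact_hom_from_mid h X f).1 hf

lemma exists_desc (h𝒞 : 𝒞.IsWeaklyExtriangulated) (h : 𝒞.IsTriangle x y δ) {X : C} (f : B ⟶ X)
    (hf : x ≫ f = 0) : ∃ g : D ⟶ X, y ≫ g = f :=
  (h𝒞.exact_hom_to_mid h X f).1 hf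

lemma exists_section (h𝒞 : 𝒞.IsWeaklyExtriangulated) (h : 𝒞.IsTriangle x y δ) {X : C} (f : X ⟶ D)
    (hf : 𝒞.pull f δ = 0) : ∃ g : X ⟶ B, g ≫ y = f :=
  (h𝒞.exact_hom_from_right h X f).1 hf

lemma exists_extend (h𝒞 : 𝒞.IsWeaklyExtriangulated) (h : 𝒞.IsTriangle x y δ) {X : C} (f : A ⟶ X)
    (hf : 𝒞.push f δ = 0) : ∃ g : B ⟶ X, x ≫ g = f :=
  (h𝒞.exact_hom_to_left h X f).1 hf

lemma split (h𝒞 : 𝒞.IsWeaklyExtriangulated) (h : 𝒞.IsTriangle x y (0 : 𝒞.Ext D A)) :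
    ∃ (r : B ⟶ A) (s : D ⟶ B), x ≫ r = 𝟙 A ∧ s ≫ y = 𝟙 D ∧ r ≫ x + y ≫ s = 𝟙 B ∧ s ≫ r = 0 := by
  obtain ⟨s, hs⟩ := h.exists_section h𝒞 (𝟙 D) (by simp)
  -- `r₀` need not be compatible with `s`; it serves only to cancel `x` on the right. The retraction
  -- that is kept is `r`.
  obtain ⟨r₀, hr₀⟩ := h.exists_extend h𝒞 (𝟙 A) (by simp)
  obtain ⟨r, hr⟩ := h.exists_lift h𝒞 (𝟙 B - y ≫ s) (by simp [hs])
  have hxr : x ≫ r = 𝟙 A := by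
    have : (x ≫ r) ≫ x = x := by
      rw [Category.assoc, hr, Preadditive.comp_sub, ← Category.assoc, h.comp_eq_zero h𝒞]; simp
    have := this =≫ r₀
    simpa [hr₀] using this
  refine ⟨r, s, hxr, hs, by rw [hr]; simp, ?_⟩
  have : (s ≫ r) ≫ x = 0 := by
    rw [Category.assoc, hr, Preadditive.comp_sub, ← Category.assoc, hs]; simp
  have := this =≫ r₀
  simpa [hr₀] using this

lemma of_split (h𝒞 : 𝒞.IsWeaklyExtriangulated) {r : B ⟶ A} {s : D ⟶ B} (hxr : x ≫ r = 𝟙 A)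
    (hsy : s ≫ y = 𝟙 D) (h1 : r ≫ x + y ≫ s = 𝟙 B) : 𝒞.IsTriangle x y (0 : 𝒞.Ext D A) := by
  have hxy : x ≫ y = 0 := by
    have := x ≫= h1
    rw [Preadditive.comp_add, ← Category.assoc, hxr] at this
    have h2 : x ≫ y ≫ s = 0 := by simpa using this
    have := h2 =≫ y
    simpa [hsy] using this
  obtain ⟨B', x', y', h'⟩ := exists_triangle (0 : 𝒞.Ext D A)
  obtain ⟨r', s', hxr', hsy', h1', hsr'⟩ := h'.split h𝒞
  have hxy' := h'.comp_eq_zero h𝒞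
  have hsr : s ≫ r = 0 := by
    have := s ≫= h1
    rw [Preadditive.comp_add, ← Category.assoc s y, hsy] at this
    have h2 : s ≫ r ≫ x = 0 := by simpa using this
    have := h2 =≫ r
    simpa [hxr] using this
  have a1 := reassoc_of% hxr
  have a2 := reassoc_of% hsy
  have a3 := reassoc_of% hxr'
  have a4 := reassoc_of% hsy'
  have a5 := reassoc_of% hxy
  have a6 := reassoc_of% hxy'
  have a7 := reassoc_of% hsr
  have a8 := reassoc_of% hsr'
  refine h'.of_iso ⟨r' ≫ x + y' ≫ s, r ≫ x' + y ≫ s', ?_, ?_⟩ ?_ ?_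
  · simp [a1, a2, a5, a7, h1']
  · simp [a3, a4, a6, a8, h1]
  · simp [a3, a6]
  · simp [hxy, hsy]

end IsTriangle

lemma triangle_inl (h𝒞 : 𝒞.IsWeaklyExtriangulated) (X Y : C) :
    𝒞.IsTriangle (biprod.inl : X ⟶ X ⊞ Y) (biprod.snd : X ⊞ Y ⟶ Y) 0 :=
  .of_split h𝒞 (r := biprod.fst) (s := biprod.inr) (by simp) (by simp) (by simp)

/-- The change of sign in the first summand. -/
@[simps]
noncomputable def negLeft (X Y : C) : X ⊞ Y ≅ X ⊞ Y where
  hom := biprod.map (-𝟙 X) (𝟙 Y)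
  inv := biprod.map (-𝟙 X) (𝟙 Y)
  hom_inv_id := by ext <;> simp
  inv_hom_id := by ext <;> simp

/-- Exactness of `C(Z, D) ⟶ 𝔼(Z, A) ⟶ 𝔼(Z, B)`. -/
lemma IsTriangle.exists_pull_eq (h𝒞 : 𝒞.IsWeaklyExtriangulated) {A B D Z : C} {x : A ⟶ B}
    {y : B ⟶ D} {δ : 𝒞.Ext D A} (h : 𝒞.IsTriangle x y δ) (θ : 𝒞.Ext Z A)
    (hθ : 𝒞.push x θ = 0) : ∃ c : Z ⟶ D, 𝒞.pull c δ = θ := by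
  -- `η` glues `δ` and `θ`. Since `x_* η = 0`, the cocone triangle of the good lift along
  -- `biprod.inl` splits. The section restricted to `Z` writes `biprod.inr` as `c ≫ biprod.inl + t ≫
  -- q`; pulling `η` back along this kills the second term, as `q^* η = 0`.
  set η : 𝒞.Ext (D ⊞ Z) A := 𝒞.pull biprod.fst δ + 𝒞.pull biprod.snd θ with hη
  have h1 : 𝒞.pull biprod.inl η = δ := by
    rw [hη, pull_add, ← pull_comp, ← pull_comp]; simp [pull_id]
  have h2 : 𝒞.pull biprod.inr η = θ := by
    rw [hη, pull_add, ← pull_comp, ← pull_comp]; simp [pull_id]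
  have h3 : 𝒞.push x η = 0 := by
    rw [hη, push_add, push_pull, push_pull, hθ, h.push_ι h𝒞]; simp
  obtain ⟨U, p, q, hU⟩ := exists_triangle η
  obtain ⟨b, -, -, hb⟩ := h𝒞.exists_good_lift_pull biprod.inl hU (by rw [h1]; exact h)
  rw [h3] at hb
  obtain ⟨-, s, -, hs, -, -⟩ := hb.split h𝒞
  set c : Z ⟶ D := biprod.inr ≫ s ≫ biprod.fst
  set t : Z ⟶ U := biprod.inr ≫ s ≫ biprod.snd
  have hct : c ≫ biprod.inl + t ≫ q = biprod.inr := by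
    have := biprod.inr ≫= hs
    rw [biprod.desc_eq] at this
    simpa [c, t] using this
  refine ⟨c, ?_⟩
  have := congrArg (fun f => 𝒞.pull f η) hct
  simp only [add_pull, pull_comp, hU.pull_π h𝒞, h1, h2, pull_zero, add_zero] at this
  exact this

/-- The cone of an inflation is unique up to isomorphism. -/
lemma IsTriangle.cone_unique (h𝒞 : 𝒞.IsWeaklyExtriangulated) {A B D D' : C} {x : A ⟶ B}
    {y : B ⟶ D} {y' : B ⟶ D'} {δ : 𝒞.Ext D A} {δ' : 𝒞.Ext D' A} (h : 𝒞.IsTriangle x y δ)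
    (h' : 𝒞.IsTriangle x y' δ') : ∃ c : D' ≅ D, y' ≫ c.hom = y ∧ 𝒞.pull c.hom δ = δ' := by
  -- A map `c` with `c^* δ = δ'` need not satisfy `y' ≫ c = y`. The defect comes from `b - 𝟙 B`,
  -- which factors through `y'` as `y' ≫ g`; subtracting `g ≫ y` repairs it without changing `c^*
  -- δ`, because `y^* δ = 0`.
  have key : ∀ {D D' : C} {y : B ⟶ D} {y' : B ⟶ D'} {δ : 𝒞.Ext D A} {δ' : 𝒞.Ext D' A},
      𝒞.IsTriangle x y δ → 𝒞.IsTriangle x y' δ' →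
      ∃ c : D' ⟶ D, y' ≫ c = y ∧ 𝒞.pull c δ = δ' := by
    intro D D' y y' δ δ' h h'
    obtain ⟨c, hc⟩ := h.exists_pull_eq h𝒞 δ' (h'.push_ι h𝒞)
    obtain ⟨b, hb1, hb2, -⟩ := h𝒞.exists_good_lift_pull c h (by rw [hc]; exact h')
    obtain ⟨g, hg⟩ := h'.exists_desc h𝒞 (b - 𝟙 B) (by simp [hb1])
    refine ⟨c - g ≫ y, ?_, ?_⟩
    · rw [Preadditive.comp_sub, ← Category.assoc, hg, ← hb2]; simp
    · rw [sub_eq_add_neg, add_pull, neg_pull, pull_comp, h.pull_π h𝒞, hc]; simp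
  obtain ⟨c₁, h₁, h₁'⟩ := key h h'
  obtain ⟨c₂, h₂, h₂'⟩ := key h' h
  -- Here `c - 𝟙 D` factors through `y` and is killed by `y`, so its square is zero and `2 - c` is
  -- inverse to `c`.
  have hinv : ∀ {D : C} {y : B ⟶ D} {δ : 𝒞.Ext D A} (_ : 𝒞.IsTriangle x y δ) (c : D ⟶ D),
      y ≫ c = y → 𝒞.pull c δ = δ → IsIso c := by
    intro D y δ h c hc hc'
    obtain ⟨g, hg⟩ := h.exists_section h𝒞 (c - 𝟙 D) (by
      rw [sub_eq_add_neg, add_pull, neg_pull, hc', pull_id]; simp)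
    have hu : y ≫ (c - 𝟙 D) = 0 := by simp [hc]
    have huu : (c - 𝟙 D) ≫ (c - 𝟙 D) = 0 := by
      nth_rw 1 [← hg]; rw [Category.assoc, hu, comp_zero]
    simp only [Preadditive.comp_sub, Preadditive.sub_comp, Category.id_comp, Category.comp_id] at huu
    refine ⟨𝟙 D + 𝟙 D - c, ?_, ?_⟩
    · simp only [Preadditive.comp_sub, Preadditive.comp_add, Category.comp_id]
      rw [← sub_eq_zero, ← neg_eq_zero, ← huu]; abel
    · simp only [Preadditive.sub_comp, Preadditive.add_comp, Category.id_comp]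
      rw [← sub_eq_zero, ← neg_eq_zero, ← huu]; abel
  have i1 : IsIso (c₁ ≫ c₂) := hinv h' _ (by rw [← Category.assoc, h₁, h₂])
    (by rw [pull_comp, h₂', h₁'])
  have i2 : IsIso (c₂ ≫ c₁) := hinv h _ (by rw [← Category.assoc, h₂, h₁])
    (by rw [pull_comp, h₁', h₂'])
  have : IsIso c₁ := by
    have : IsSplitMono c₁ := ⟨⟨⟨c₂ ≫ inv (c₁ ≫ c₂), by rw [← Category.assoc]; simp⟩⟩⟩
    have : Epi c₁ := epi_of_epi c₂ c₁
    exact isIso_of_epi_of_isSplitMono c₁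
  exact ⟨asIso c₁, h₁, h₁'⟩

/-- If `b` is a good lift of the pushforward along an inflation `a`, then `b` is an inflation with
the same cone. -/
lemma IsTriangle.of_good_lift_push (h𝒞 : 𝒞.IsWeaklyExtriangulated) {A B A' B' V : C}
    {x : A ⟶ B} {a : A ⟶ A'} {q : A' ⟶ V} {ν : 𝒞.Ext V A} (ha : 𝒞.IsTriangle a q ν)
    {x' : A' ⟶ B'} {b : B ⟶ B'} {η : 𝒞.Ext B' A}
    (hb : 𝒞.IsTriangle (biprod.lift x a) (biprod.desc b (-x')) η) :
    ∃ y'' : B' ⟶ V, 𝒞.IsTriangle b y'' (𝒞.push x ν) := by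
  obtain ⟨Q, p, q', hQ⟩ := exists_triangle (𝒞.push x ν)
  -- The roles of `x` and `a` are exchanged: both good lifts give triangles starting with
  -- `biprod.lift x a`, up to the order of summands. Uniqueness of cones identifies `b` with `-p`.
  obtain ⟨b', -, -, hb'⟩ := h𝒞.exists_good_lift_push x ha hQ
  have hb2 : 𝒞.IsTriangle (biprod.lift x a) (biprod.desc (-p) b') _ :=
    hb'.of_iso (biprod.braiding A' B) (by ext <;> simp) (by ext <;> simp)
  obtain ⟨c, hc, -⟩ := hb.cone_unique h𝒞 hb2
  have hc' : -p ≫ c.hom = b := by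
    have := biprod.inl ≫= hc
    simpa using this
  refine ⟨-c.inv ≫ q', hQ.of_iso ⟨-c.hom, -c.inv, by simp, by simp⟩ ?_ ?_⟩
  · simp [← hc']
  · simp

/-- Equivalence of sequences fixes the end terms, so changing `D` needs an argument. For a
realization `r, r'` of the pulled back extension, the cocone triangle of the good lift `b` has class
`r_* δ`. This vanishes after pullback along an isomorphism, hence vanishes; the resulting splitting
inverts `b`. -/
lemma IsTriangle.of_iso_right (h𝒞 : 𝒞.IsWeaklyExtriangulated) {A B D D' : C} {x : A ⟶ B}
    {y : B ⟶ D} {δ : 𝒞.Ext D A} (h : 𝒞.IsTriangle x y δ) (e : D ≅ D') :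
    𝒞.IsTriangle x (y ≫ e.hom) (𝒞.pull e.inv δ) := by
  obtain ⟨R, r, r', hr⟩ := exists_triangle (𝒞.pull e.inv δ)
  obtain ⟨b, hb₁, hb₂, hb₃⟩ := h𝒞.exists_good_lift_pull e.inv h hr
  have hz : 𝒞.push r δ = 0 := by
    have h2 := congrArg (fun f => 𝒞.pull f (𝒞.push r δ)) e.hom_inv_id
    simp only [pull_comp, pull_id] at h2
    rw [← h2, ← push_pull, hr.push_ι h𝒞, pull_zero]
  rw [hz] at hb₃
  obtain ⟨ρ, -, hρ, -⟩ := hb₃.split h𝒞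
  obtain ⟨g, hg⟩ := hb₃.exists_lift h𝒞 (biprod.lift (-(y ≫ e.hom)) (𝟙 B)) (by simp)
  have hg1 : g ≫ b = 𝟙 B := by
    have := hg =≫ biprod.snd
    simpa using this
  have hg2 : g ≫ r' = y ≫ e.hom := by
    have := hg =≫ biprod.fst
    simpa using this
  have hg3 : b ≫ g = 𝟙 R := by
    have : (b ≫ g) ≫ biprod.lift (-r') b = biprod.lift (-r') b := by
      rw [Category.assoc, hg]
      ext
      · simp [reassoc_of% hb₂]
      · simp
    have := this =≫ ρ
    simpa [hρ] using this
  exact hr.of_iso ⟨b, g, hg3, hg1⟩ hb₁ (by simp [reassoc_of% hb₂])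

/-- If `b` is a good lift of the pushforward along a deflation `a`, then `b` is a deflation with
the same cocone. -/
lemma IsTriangle.of_good_lift_push' (h𝒞 : 𝒞.IsWeaklyExtriangulated)
    (hcomp : 𝒞.inflations.IsStableUnderComposition) {A B D A' B' M : C} {x : A ⟶ B}
    {y : B ⟶ D} {δ : 𝒞.Ext D A} (h : 𝒞.IsTriangle x y δ) {m : M ⟶ A} {a : A ⟶ A'}
    {μ : 𝒞.Ext A' M} (ha : 𝒞.IsTriangle m a μ) {x' : A' ⟶ B'} {b : B ⟶ B'} {η : 𝒞.Ext B' A}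
    (hb : 𝒞.IsTriangle (biprod.lift x a) (biprod.desc b (-x')) η) :
    𝒞.IsConflation (m ≫ x) b := by
  obtain ⟨V, n, ν, hν⟩ := hcomp.comp_mem m x ⟨_, _, _, ha⟩ ⟨_, _, _, h⟩
  obtain ⟨c, hc⟩ := hν.exists_pull_eq h𝒞 μ (by rw [push_comp, ha.push_ι h𝒞, push_zero])
  obtain ⟨b₀, hb₁, hb₂, hb₀⟩ := h𝒞.exists_good_lift_pull c hν (by rw [hc]; exact ha)
  obtain ⟨g, hg⟩ := ha.exists_desc h𝒞 (b₀ - x) (by simp [hb₁])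
  -- The good lift `b₀` agrees with `x` only after `m`. The triangular change of coordinates below
  -- absorbs the difference `a ≫ g`, so that both triangles begin with `biprod.lift x a` and their
  -- cones can be compared.
  have hgt : b₀ = x + a ≫ g := by rw [hg]; abel
  have hb2 : 𝒞.IsTriangle (biprod.lift x a) (biprod.desc n (-c + g ≫ n)) _ :=
    hb₀.of_iso ⟨biprod.desc (biprod.lift g (-𝟙 _)) (biprod.lift (𝟙 _) 0),
      biprod.desc (biprod.lift 0 (𝟙 _)) (biprod.lift (-𝟙 _) g),
      by ext <;> simp, by ext <;> simp⟩
      (by ext <;> simp [hgt]) (by ext <;> simp)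
  obtain ⟨e, he, -⟩ := hb.cone_unique h𝒞 hb2
  have he' : n ≫ e.hom = b := by
    have := biprod.inl ≫= he
    simpa using this
  rw [← he']
  exact ⟨_, hν.of_iso_right h𝒞 e⟩

end Exactness
end Data

namespace Data

/-! ### Duality for extriangulated categories and thick subcategories -/

section Duality

variable [Preadditive C]

/-- The dual triplet on the opposite category. -/
def op (𝒞 : Data.{v, u, w} C) : Data.{v, u, w} Cᵒᵖ where
  E := unopUnop C ⋙ 𝒞.E.flip
  additive_fst := ⟨fun {X Y f g} => by
    have := 𝒞.additive_snd
    ext Z : 2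
    simp [Functor.map_add]⟩
  additive_snd X := ⟨fun {Y Z f g} => by
    have := 𝒞.additive_fst
    simp [Functor.map_add]⟩
  real {A D} δ := Quotient.map (sa := seqSetoid (unop D) (unop A)) (sb := seqSetoid A D)
    (fun s => ⟨Opposite.op s.mid, s.π.op, s.ι.op⟩)
    (by
      rintro s t ⟨b, h₁, h₂⟩
      exact ⟨b.symm.op, by simp [← h₂, ← op_comp], by simp [← h₁, ← op_comp]⟩)
    (𝒞.real (A := unop D) (D := unop A) δ)

variable {𝒞 : Data.{v, u, w} C}

lemma isTriangle_op_iff {A B D : Cᵒᵖ} (x : A ⟶ B) (y : B ⟶ D) (δ : 𝒞.op.Ext D A) :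
    𝒞.op.IsTriangle x y δ ↔ 𝒞.IsTriangle (A := unop D) (D := unop A) y.unop x.unop δ := by
  constructor
  · intro h
    obtain ⟨B', x', y', h'⟩ := exists_triangle (𝒞 := 𝒞) (A := unop D) (D := unop A) δ
    unfold IsTriangle op at h
    simp only at h
    rw [h', Quotient.map_mk] at h
    obtain ⟨e, h₁, h₂⟩ := Quotient.exact h
    refine h'.of_iso e.unop.symm ?_ ?_
    · apply Quiver.Hom.op_inj
      simp at h₂ ⊢
      rw [← h₂]; simp
    · apply Quiver.Hom.op_inj
      simp at h₁ ⊢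
      rw [← h₁]; simp
  · intro h
    unfold IsTriangle op
    simp only
    rw [h, Quotient.map_mk]
    rfl

lemma isTriangle_op {A B D : C} {x : A ⟶ B} {y : B ⟶ D} {δ : 𝒞.Ext D A} (h : 𝒞.IsTriangle x y δ) :
    𝒞.op.IsTriangle (A := Opposite.op D) (D := Opposite.op A) y.op x.op δ :=
  (isTriangle_op_iff _ _ _).2 h

lemma isConflation_op_iff {A B D : Cᵒᵖ} (x : A ⟶ B) (y : B ⟶ D) :
    𝒞.op.IsConflation x y ↔ 𝒞.IsConflation y.unop x.unop :=
  exists_congr fun δ => isTriangle_op_iff x y δ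

lemma inflations_op_iff {A B : Cᵒᵖ} (x : A ⟶ B) : 𝒞.op.inflations x ↔ 𝒞.deflations x.unop := by
  constructor
  · rintro ⟨D, y, h⟩
    exact ⟨_, _, (isConflation_op_iff _ _).1 h⟩
  · rintro ⟨D, y, h⟩
    exact ⟨Opposite.op D, y.op, (isConflation_op_iff _ _).2 h⟩

lemma deflations_op_iff {A B : Cᵒᵖ} (x : A ⟶ B) : 𝒞.op.deflations x ↔ 𝒞.inflations x.unop := by
  constructor
  · rintro ⟨D, y, h⟩
    exact ⟨_, _, (isConflation_op_iff _ _).1 h⟩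
  · rintro ⟨D, y, h⟩
    exact ⟨Opposite.op D, y.op, (isConflation_op_iff _ _).2 h⟩

variable [HasBinaryBiproducts C]

/-- The comparison of a biproduct in the opposite category with the opposite biproduct. -/
noncomputable def opBiprodIso (X Y : Cᵒᵖ) : unop (X ⊞ Y) ≅ unop X ⊞ unop Y where
  hom := biprod.lift (biprod.inl : X ⟶ X ⊞ Y).unop (biprod.inr : Y ⟶ X ⊞ Y).unop
  inv := biprod.desc (biprod.fst : X ⊞ Y ⟶ X).unop (biprod.snd : X ⊞ Y ⟶ Y).unop
  hom_inv_id := by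
    apply Quiver.Hom.op_inj
    simp [biprod.lift_desc]
  inv_hom_id := by
    ext <;> simp [← unop_comp]

lemma opBiprodIso_lift {W X Y : Cᵒᵖ} (f : W ⟶ X) (g : W ⟶ Y) :
    (opBiprodIso X Y).inv ≫ (biprod.lift f g).unop = biprod.desc f.unop g.unop := by
  ext <;> simp [opBiprodIso, ← unop_comp]

lemma opBiprodIso_desc {W X Y : Cᵒᵖ} (f : X ⟶ W) (g : Y ⟶ W) :
    (biprod.desc f g).unop ≫ (opBiprodIso X Y).hom = biprod.lift f.unop g.unop := by
  ext <;> simp [opBiprodIso, ← unop_comp]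

lemma isTriangle_op_biprod_iff {A X Y D : Cᵒᵖ} (f : A ⟶ X) (g : A ⟶ Y) (f' : X ⟶ D) (g' : Y ⟶ D)
    (δ : 𝒞.op.Ext D A) : 𝒞.op.IsTriangle (biprod.lift f g) (biprod.desc f' g') δ ↔
      𝒞.IsTriangle (A := unop D) (D := unop A) (biprod.lift f'.unop g'.unop)
        (biprod.desc f.unop g.unop) δ := by
  rw [isTriangle_op_iff]
  constructor
  · intro h
    exact h.of_iso (opBiprodIso X Y) (opBiprodIso_desc _ _) (by rw [← opBiprodIso_lift]; simp)
  · intro h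
    exact h.of_iso (opBiprodIso X Y).symm (by rw [← opBiprodIso_desc]; simp)
      (by simp [opBiprodIso_lift])

variable [HasZeroObject C]

/-- The axioms come in dual pairs. In the good lift axioms, passing to the opposite reverses the
order of the summands, whence the braiding. -/
lemma IsWeaklyExtriangulated.op (h : 𝒞.IsWeaklyExtriangulated) :
    𝒞.op.IsWeaklyExtriangulated where
  exact_hom_from_mid {A B D x y δ} hT X g := by
    rw [isTriangle_op_iff] at hT
    have := h.exact_hom_to_mid hT (unop X) g.unop
    constructor
    · intro hg
      obtain ⟨k, hk⟩ := this.1 (congrArg Quiver.Hom.unop hg)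
      exact ⟨k.op, congrArg Quiver.Hom.op hk⟩
    · rintro ⟨k, hk⟩
      exact congrArg Quiver.Hom.op (this.2 ⟨k.unop, congrArg Quiver.Hom.unop hk⟩)
  exact_hom_from_right {A B D x y δ} hT X g := by
    rw [isTriangle_op_iff] at hT
    have := h.exact_hom_to_left hT (unop X) g.unop
    constructor
    · intro hg
      obtain ⟨k, hk⟩ := this.1 hg
      exact ⟨k.op, congrArg Quiver.Hom.op hk⟩
    · rintro ⟨k, hk⟩
      exact this.2 ⟨k.unop, congrArg Quiver.Hom.unop hk⟩
  exact_hom_to_mid {A B D x y δ} hT X g := by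
    rw [isTriangle_op_iff] at hT
    have := h.exact_hom_from_mid hT (unop X) g.unop
    constructor
    · intro hg
      obtain ⟨k, hk⟩ := this.1 (congrArg Quiver.Hom.unop hg)
      exact ⟨k.op, congrArg Quiver.Hom.op hk⟩
    · rintro ⟨k, hk⟩
      exact congrArg Quiver.Hom.op (this.2 ⟨k.unop, congrArg Quiver.Hom.unop hk⟩)
  exact_hom_to_left {A B D x y δ} hT X g := by
    rw [isTriangle_op_iff] at hT
    have := h.exact_hom_from_right hT (unop X) g.unop
    constructor
    · intro hg
      obtain ⟨k, hk⟩ := this.1 hg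
      exact ⟨k.op, congrArg Quiver.Hom.op hk⟩
    · rintro ⟨k, hk⟩
      exact this.2 ⟨k.unop, congrArg Quiver.Hom.unop hk⟩
  triangle_id_zero A := by
    rw [isTriangle_op_iff]
    exact .of_split h (r := 0) (s := 𝟙 _)
      (Quiver.Hom.op_inj (HasZeroObject.to_zero_ext _ _)) (by simp) (by simp)
  triangle_zero_id A := by
    rw [isTriangle_op_iff]
    exact .of_split h (r := 𝟙 _) (s := 0) (by simp)
      (Quiver.Hom.op_inj (HasZeroObject.to_zero_ext _ _)) (by simp)
  exists_good_lift_push {A B D A' B' x y δ} a {x' y'} hT hT' := by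
    rw [isTriangle_op_iff] at hT hT'
    obtain ⟨b, h₁, h₂, h₃⟩ := h.exists_good_lift_pull a.unop hT hT'
    refine ⟨b.op, congrArg Quiver.Hom.op h₂, congrArg Quiver.Hom.op h₁, ?_⟩
    rw [isTriangle_op_biprod_iff]
    exact IsTriangle.of_iso h₃ (biprod.braiding _ _) (by ext <;> simp) (by ext <;> simp)
  exists_good_lift_pull {A B D B' D' x y δ} c {x' y'} hT hT' := by
    rw [isTriangle_op_iff] at hT hT'
    obtain ⟨b, h₁, h₂, h₃⟩ := h.exists_good_lift_push c.unop hT hT'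
    refine ⟨b.op, congrArg Quiver.Hom.op h₂, congrArg Quiver.Hom.op h₁, ?_⟩
    rw [isTriangle_op_biprod_iff]
    exact IsTriangle.of_iso h₃ (biprod.braiding _ _) (by ext <;> simp) (by ext <;> simp)

lemma IsExtriangulated.op (h : 𝒞.IsExtriangulated) : 𝒞.op.IsExtriangulated where
  toIsWeaklyExtriangulated := h.toIsWeaklyExtriangulated.op
  inflations_comp := ⟨fun f g hf hg => by
    rw [inflations_op_iff] at *
    exact h.deflations_comp.comp_mem _ _ hg hf⟩
  deflations_comp := ⟨fun f g hf hg => by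
    rw [deflations_op_iff] at *
    exact h.inflations_comp.comp_mem _ _ hg hf⟩

lemma IsThick.op {N : ObjectProperty C} (h : 𝒞.IsThick N) : 𝒞.op.IsThick N.op where
  zero_mem := h.of_iso ((isZero_zero C).iso (isZero_zero Cᵒᵖ).unop) h.zero_mem
  biprod_mem {X Y} hX hY := h.of_iso (opBiprodIso X Y).symm (h.biprod_mem hX hY)
  of_iso e hX := h.of_iso e.unop.symm hX
  of_biprod_left {X Y} hXY := h.of_biprod_left (h.of_iso (opBiprodIso X Y) hXY)
  of_biprod_right {X Y} hXY := h.of_biprod_right (h.of_iso (opBiprodIso X Y) hXY)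
  mem_right hc hA hB := h.mem_left ((isConflation_op_iff _ _).1 hc) hB hA
  mem_mid hc hA hB := h.mem_mid ((isConflation_op_iff _ _).1 hc) hB hA
  mem_left hc hA hB := h.mem_right ((isConflation_op_iff _ _).1 hc) hB hA

lemma IsBiresolvingThick.op {N : ObjectProperty C} (h : 𝒞.IsBiresolvingThick N) :
    𝒞.op.IsBiresolvingThick N.op where
  toIsThick := h.toIsThick.op
  exists_inflation X := by
    obtain ⟨M, j, hM, hj⟩ := h.exists_deflation (unop X)
    exact ⟨Opposite.op M, j.op, hM, (inflations_op_iff _).2 hj⟩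
  exists_deflation X := by
    obtain ⟨M, j, hM, hj⟩ := h.exists_inflation (unop X)
    exact ⟨Opposite.op M, j.op, hM, (deflations_op_iff _).2 hj⟩

end Duality
end Data

/-! ### Duality for `ℒ`, `ℛ` and `𝒮` -/

section

variable [Preadditive C] {𝒞 : Data.{v, u, w} C} {N : ObjectProperty C}

lemma classL_op_iff {X Y : Cᵒᵖ} (f : X ⟶ Y) : classL 𝒞.op N.op f ↔ classR 𝒞 N f.unop := by
  constructor
  · rintro ⟨D, y, h, hD⟩
    exact ⟨_, _, (Data.isConflation_op_iff _ _).1 h, hD⟩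
  · rintro ⟨D, y, h, hD⟩
    exact ⟨op D, y.op, (Data.isConflation_op_iff _ _).2 h, hD⟩

lemma classR_op_iff {X Y : Cᵒᵖ} (f : X ⟶ Y) : classR 𝒞.op N.op f ↔ classL 𝒞 N f.unop := by
  constructor
  · rintro ⟨D, y, h, hD⟩
    exact ⟨_, _, (Data.isConflation_op_iff _ _).1 h, hD⟩
  · rintro ⟨D, y, h, hD⟩
    exact ⟨op D, y.op, (Data.isConflation_op_iff _ _).2 h, hD⟩

lemma classS_op_iff {X Y : Cᵒᵖ} (f : X ⟶ Y) : classS 𝒞.op N.op f ↔ classS 𝒞 N f.unop := by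
  constructor
  · intro h
    induction h with
    | of_L f hf => exact .of_R _ ((classL_op_iff _).1 hf)
    | of_R f hf => exact .of_L _ ((classR_op_iff _).1 hf)
    | comp f g _ _ hf hg => exact .comp _ _ hg hf
  · intro h
    have : ∀ {X Y : C} (f : X ⟶ Y), classS 𝒞 N f → classS 𝒞.op N.op f.op := by
      intro X Y f h
      induction h with
      | of_L f hf => exact .of_R _ ((classR_op_iff _).2 hf)
      | of_R f hf => exact .of_L _ ((classL_op_iff _).2 hf)
      | comp f g _ _ hf hg => exact .comp _ _ hg hf
    exact this _ h

end

/-! ### Monomorphisms and epimorphisms modulo the ideal `[N]` -/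

section Ideal

/-- The morphisms which factor through an object of `N`. -/
def Factors (N : ObjectProperty C) {X Y : C} (f : X ⟶ Y) : Prop :=
  ∃ (M : C) (i : X ⟶ M) (j : M ⟶ Y), N M ∧ f = i ≫ j

/-- The morphisms which are monomorphisms modulo the ideal of morphisms factoring through `N`. -/
def MonoMod (N : ObjectProperty C) {X Y : C} (f : X ⟶ Y) : Prop :=
  ∀ ⦃W : C⦄ (h : W ⟶ X), Factors N (h ≫ f) → Factors N h

/-- The morphisms which are epimorphisms modulo the ideal of morphisms factoring through `N`. -/
def EpiMod (N : ObjectProperty C) {X Y : C} (f : X ⟶ Y) : Prop :=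
  ∀ ⦃W : C⦄ (h : Y ⟶ W), Factors N (f ≫ h) → Factors N h

variable {N : ObjectProperty C}

lemma Factors.precomp {W X Y : C} {f : X ⟶ Y} (h : Factors N f) (g : W ⟶ X) :
    Factors N (g ≫ f) := by
  obtain ⟨M, i, j, hM, rfl⟩ := h
  exact ⟨M, g ≫ i, j, hM, by simp⟩

lemma Factors.postcomp {X Y Z : C} {f : X ⟶ Y} (h : Factors N f) (g : Y ⟶ Z) :
    Factors N (f ≫ g) := by
  obtain ⟨M, i, j, hM, rfl⟩ := h
  exact ⟨M, i, j ≫ g, hM, by simp⟩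

lemma Factors.of_source {X Y : C} (hX : N X) (f : X ⟶ Y) : Factors N f :=
  ⟨X, 𝟙 X, f, hX, by simp⟩

lemma MonoMod.comp {X Y Z : C} {f : X ⟶ Y} {g : Y ⟶ Z} (hf : MonoMod N f) (hg : MonoMod N g) :
    MonoMod N (f ≫ g) :=
  fun _ h hh => hf h (hg _ (by simpa using hh))

lemma EpiMod.comp {X Y Z : C} {f : X ⟶ Y} {g : Y ⟶ Z} (hf : EpiMod N f) (hg : EpiMod N g) :
    EpiMod N (f ≫ g) :=
  fun _ h hh => hg h (hf _ (by simpa using hh))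

lemma factors_op_iff {X Y : Cᵒᵖ} (f : X ⟶ Y) : Factors N.op f ↔ Factors N f.unop := by
  constructor
  · rintro ⟨M, i, j, hM, rfl⟩
    exact ⟨_, j.unop, i.unop, hM, rfl⟩
  · rintro ⟨M, i, j, hM, h⟩
    exact ⟨op M, j.op, i.op, hM, by rw [← op_comp, ← h]; rfl⟩

lemma monoMod_op_iff {X Y : Cᵒᵖ} (f : X ⟶ Y) : MonoMod N.op f ↔ EpiMod N f.unop := by
  constructor
  · intro h W g hg
    exact (factors_op_iff _).1 (h g.op ((factors_op_iff _).2 hg))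
  · intro h W g hg
    exact (factors_op_iff _).2 (h g.unop ((factors_op_iff _).1 hg))

lemma epiMod_op_iff {X Y : Cᵒᵖ} (f : X ⟶ Y) : EpiMod N.op f ↔ MonoMod N f.unop := by
  constructor
  · intro h W g hg
    exact (factors_op_iff _).1 (h g.op ((factors_op_iff _).2 hg))
  · intro h W g hg
    exact (factors_op_iff _).2 (h g.unop ((factors_op_iff _).1 hg))

variable [Preadditive C]

lemma Factors.neg {X Y : C} {f : X ⟶ Y} (h : Factors N f) : Factors N (-f) := by
  obtain ⟨M, i, j, hM, rfl⟩ := h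
  exact ⟨M, -i, j, hM, by simp⟩

lemma Factors.zero [HasZeroObject C] (h0 : N 0) {X Y : C} : Factors N (0 : X ⟶ Y) :=
  ⟨0, 0, 0, h0, by simp⟩

variable [HasBinaryBiproducts C]

lemma Factors.add (hN : ∀ {X Y : C}, N X → N Y → N (X ⊞ Y)) {X Y : C} {f g : X ⟶ Y}
    (hf : Factors N f) (hg : Factors N g) : Factors N (f + g) := by
  obtain ⟨M, i, j, hM, rfl⟩ := hf
  obtain ⟨M', i', j', hM', rfl⟩ := hg
  exact ⟨M ⊞ M', biprod.lift i i', biprod.desc j j', hN hM hM', by simp⟩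

lemma Factors.sub (hN : ∀ {X Y : C}, N X → N Y → N (X ⊞ Y)) {X Y : C} {f g : X ⟶ Y}
    (hf : Factors N f) (hg : Factors N g) : Factors N (f - g) := by
  rw [sub_eq_add_neg]
  exact hf.add hN hg.neg

end Ideal

/-! ### Enlarging morphisms to inflations and deflations; retracts -/

section

variable [Preadditive C] [HasZeroObject C] [HasBinaryBiproducts C] {𝒞 : Data.{v, u, w} C}
  {N : ObjectProperty C}

namespace Data

lemma inflation_lift (h𝒞 : 𝒞.IsWeaklyExtriangulated) {A B A' : C} {x : A ⟶ B}
    (hx : 𝒞.inflations x) (a : A ⟶ A') : 𝒞.inflations (biprod.lift x a) := by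
  obtain ⟨D, y, δ, h⟩ := hx
  obtain ⟨B', x', y', h'⟩ := exists_triangle (𝒞.push a δ)
  obtain ⟨b, -, -, hb⟩ := h𝒞.exists_good_lift_push a h h'
  exact ⟨_, _, _, hb⟩

lemma deflation_desc (h𝒞 : 𝒞.IsWeaklyExtriangulated) {B D D' : C} {y : B ⟶ D}
    (hy : 𝒞.deflations y) (c : D' ⟶ D) : 𝒞.deflations (biprod.desc c y) := by
  obtain ⟨A, x, δ, h⟩ := hy
  obtain ⟨B', x', y', h'⟩ := exists_triangle (𝒞.pull c δ)
  obtain ⟨b, -, -, hb⟩ := h𝒞.exists_good_lift_pull c h h'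
  exact ⟨_, _, _, hb⟩

/-- A biresolving thick subcategory is closed under retracts. -/
lemma IsBiresolvingThick.of_retract (h𝒞 : 𝒞.IsWeaklyExtriangulated) (hN : 𝒞.IsBiresolvingThick N)
    {L M : C} (i : L ⟶ M) (r : M ⟶ L) (hir : i ≫ r = 𝟙 L) (hM : N M) : N L := by
  obtain ⟨M', j, hM', hj⟩ := hN.exists_inflation L
  -- The section `i` need not have a complement in `C`. Adding `j` turns it into an inflation that
  -- is still a split monomorphism, so `L` becomes a biproduct summand of `M' ⊞ M`.
  obtain ⟨D, y, δ, h⟩ := inflation_lift h𝒞 hj i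
  have hδ : δ = 0 := by
    rw [← push_id δ, show 𝟙 L = biprod.lift j i ≫ biprod.desc 0 r by simp [hir], push_comp,
      h.push_ι h𝒞, push_zero]
  subst hδ
  obtain ⟨e, -⟩ := h.exists_iso (triangle_inl h𝒞 L D)
  exact hN.of_biprod_left (hN.of_iso e (hN.biprod_mem hM' hM))

lemma IsBiresolvingThick.of_factors_id (h𝒞 : 𝒞.IsWeaklyExtriangulated)
    (hN : 𝒞.IsBiresolvingThick N) {L : C} (h : Factors N (𝟙 L)) : N L := by
  obtain ⟨M, i, j, hM, h⟩ := h
  exact hN.of_retract h𝒞 i j h.symm hM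

end Data

/-! ### `𝒮` is the class of morphisms monic and epic modulo `N` -/

open Data

lemma classL_inl (h𝒞 : 𝒞.IsWeaklyExtriangulated) (X : C) {M : C} (hM : N M) :
    classL 𝒞 N (biprod.inl : X ⟶ X ⊞ M) :=
  ⟨M, biprod.snd, ⟨0, triangle_inl h𝒞 X M⟩, hM⟩

lemma classR_fst (h𝒞 : 𝒞.IsWeaklyExtriangulated) (X : C) {M : C} (hM : N M) :
    classR 𝒞 N (biprod.fst : X ⊞ M ⟶ X) :=
  ⟨M, biprod.inr, ⟨0, .of_split h𝒞 (r := biprod.snd) (s := biprod.inl) (by simp) (by simp)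
    (by rw [add_comm]; simp)⟩, hM⟩

/-- If `f ≫ g` factors as `i ≫ j` through `M`, push the conflation of `f` out along `i`. The new
middle term is an extension of objects of `N`, and `g` factors through it. -/
lemma classL.epiMod (h𝒞 : 𝒞.IsExtriangulated) (hN : 𝒞.IsBiresolvingThick N) {X Y : C} {f : X ⟶ Y}
    (hf : classL 𝒞 N f) : EpiMod N f := by
  obtain ⟨D, y, ⟨δ, h⟩, hD⟩ := hf
  rintro Z g ⟨M, i, j, hM, hg⟩
  obtain ⟨B, x', y', h'⟩ := exists_triangle (𝒞.push i δ)
  obtain ⟨b, -, -, hb⟩ := h𝒞.exists_good_lift_push i h h'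
  obtain ⟨t, ht⟩ := hb.exists_desc h𝒞.1 (biprod.desc g (-j)) (by simp [hg])
  refine ⟨B, b, t, hN.mem_mid ⟨_, h'⟩ hM hD, ?_⟩
  have := biprod.inl ≫= ht
  simpa using this.symm

/-- Given `g ≫ f = i ≫ j` through `M`, enlarge `j` to a deflation `k` from an object of `N`. The
cocone `P` of `k ≫ y` lies in `N`, and `δ` is a pushforward of its extension along some `P ⟶ X`.
Exactness of the good lift triangle then writes `g` as a map through `P` plus a map through the
source of `k`. -/
lemma classL.monoMod (h𝒞 : 𝒞.IsExtriangulated) (hN : 𝒞.IsBiresolvingThick N) {X Y : C} {f : X ⟶ Y}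
    (hf : classL 𝒞 N f) : MonoMod N f := by
  obtain ⟨D, y, ⟨δ, h⟩, hD⟩ := hf
  rintro W g ⟨M, i, j, hM, hg⟩
  obtain ⟨M₀, m, hM₀, hm⟩ := hN.exists_deflation Y
  have hk := deflation_desc h𝒞.1 hm j
  set k := biprod.desc j m with hk'
  have hM₁ : N (M ⊞ M₀) := hN.biprod_mem hM hM₀
  obtain ⟨P, p, ε, hε⟩ := h𝒞.deflations_comp.comp_mem k y hk ⟨_, _, _, h⟩
  have hP : N P := hN.mem_left ⟨_, hε⟩ hM₁ hD
  obtain ⟨a, ha⟩ := (isTriangle_op hε).exists_pull_eq h𝒞.1.op δ (by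
    change 𝒞.pull (k ≫ y) δ = 0
    rw [pull_comp, h.pull_π h𝒞.1, pull_zero])
  change 𝒞.push a.unop ε = δ at ha
  obtain ⟨b, -, hb₂, hb⟩ := h𝒞.exists_good_lift_push a.unop hε (by rw [ha]; exact h)
  obtain ⟨l, hl⟩ := h.exists_lift h𝒞.1 (b - k) (by simp [hb₂])
  set i' : W ⟶ M ⊞ M₀ := biprod.lift i 0 with hi'
  have hik : i' ≫ k = g ≫ f := by simp [hi', hk', hg]
  obtain ⟨t, ht⟩ := hb.exists_lift h𝒞.1 (biprod.lift i' (g + i' ≫ l)) (by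
    have : b = k + l ≫ f := by rw [hl]; abel
    simp [this, hik])
  have ht2 : t ≫ a.unop = g + i' ≫ l := by
    have := ht =≫ biprod.snd
    simpa using this
  have : g = t ≫ a.unop - i' ≫ l := by rw [ht2]; abel
  rw [this]
  exact (Factors.of_source hP a.unop).precomp t |>.sub hN.biprod_mem
    ((Factors.of_source hM₁ l).precomp i')

lemma classR.epiMod (h𝒞 : 𝒞.IsExtriangulated) (hN : 𝒞.IsBiresolvingThick N) {X Y : C} {f : X ⟶ Y}
    (hf : classR 𝒞 N f) : EpiMod N f :=
  (monoMod_op_iff f.op).1 (classL.monoMod h𝒞.op hN.op ((classL_op_iff f.op).2 hf))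

lemma classR.monoMod (h𝒞 : 𝒞.IsExtriangulated) (hN : 𝒞.IsBiresolvingThick N) {X Y : C} {f : X ⟶ Y}
    (hf : classR 𝒞 N f) : MonoMod N f :=
  (epiMod_op_iff f.op).1 (classL.epiMod h𝒞.op hN.op ((classL_op_iff f.op).2 hf))

lemma classS.epiMod (h𝒞 : 𝒞.IsExtriangulated) (hN : 𝒞.IsBiresolvingThick N) {X Y : C} {f : X ⟶ Y}
    (hf : classS 𝒞 N f) : EpiMod N f := by
  induction hf with
  | of_L f hf => exact hf.epiMod h𝒞 hN
  | of_R f hf => exact hf.epiMod h𝒞 hN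
  | comp f g _ _ hf hg => exact hf.comp hg

lemma classS.monoMod (h𝒞 : 𝒞.IsExtriangulated) (hN : 𝒞.IsBiresolvingThick N) {X Y : C} {f : X ⟶ Y}
    (hf : classS 𝒞 N f) : MonoMod N f := by
  induction hf with
  | of_L f hf => exact hf.monoMod h𝒞 hN
  | of_R f hf => exact hf.monoMod h𝒞 hN
  | comp f g _ _ hf hg => exact hf.comp hg

/-- If `X ⟶ 0` is monic modulo `N`, then `𝟙 X` factors through `N`, and `N` is closed under
retracts. -/
lemma nullObjects_classS (h𝒞 : 𝒞.IsExtriangulated) (hN : 𝒞.IsBiresolvingThick N) :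
    nullObjects (classS 𝒞 N) = N := by
  ext X
  constructor
  · rintro ⟨h, -⟩
    refine hN.of_factors_id h𝒞.1 (h.monoMod h𝒞 hN _ ?_)
    simpa using Factors.zero hN.zero_mem
  · intro hX
    exact ⟨.of_R _ ⟨X, 𝟙 X, ⟨0, h𝒞.triangle_id_zero X⟩, hX⟩,
      .of_L _ ⟨X, 𝟙 X, ⟨0, h𝒞.triangle_zero_id X⟩, hX⟩⟩

/-- A morphism of `ℛ` is, up to a projection with kernel in `N`, a morphism of `ℒ`. -/
lemma classR.exists_classL (h𝒞 : 𝒞.IsExtriangulated) (hN : 𝒞.IsBiresolvingThick N) {B Y : C}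
    {r : B ⟶ Y} (hr : classR 𝒞 N r) :
    ∃ (M : C) (l : B ⟶ Y ⊞ M), N M ∧ classL 𝒞 N l ∧ l ≫ biprod.fst = r := by
  obtain ⟨K, m, ⟨δ, h⟩, hK⟩ := hr
  obtain ⟨M, j, hM, hj⟩ := hN.exists_inflation B
  -- The cone `T` of `m ≫ j : K ⟶ M` lies in `N`. As `m_* δ = 0`, the extension `δ` is pulled back
  -- from `ε`, and the cocone triangle `B ⟶ Y ⊞ M ⟶ T` exhibits the desired morphism of `ℒ`.
  obtain ⟨T, q, ε, hε⟩ := h𝒞.inflations_comp.comp_mem m j ⟨_, _, _, h⟩ hj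
  obtain ⟨c, hc⟩ := hε.exists_pull_eq h𝒞.1 δ (by rw [push_comp, h.push_ι h𝒞.1, push_zero])
  obtain ⟨b, -, -, hb⟩ := h𝒞.exists_good_lift_pull c hε (by rw [hc]; exact h)
  exact ⟨M, biprod.lift r b, hM, ⟨T, biprod.desc (-c) q, ⟨_, hb.of_iso (negLeft _ _)
    (by ext <;> simp) (by ext <;> simp)⟩, hN.mem_right ⟨_, hε⟩ hK hM⟩, by simp⟩

/-- Morphisms of `𝒮` can be completed to squares commuting modulo `N`. -/
lemma classS.exists_left_square (h𝒞 : 𝒞.IsExtriangulated) (hN : 𝒞.IsBiresolvingThick N) {X Y : C}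
    {s : X ⟶ Y} (hs : classS 𝒞 N s) {Z : C} (g : X ⟶ Z) :
    ∃ (W : C) (s' : Z ⟶ W) (g' : Y ⟶ W), classS 𝒞 N s' ∧ Factors N (s ≫ g' - g ≫ s') := by
  have hL : ∀ {X Y : C} {s : X ⟶ Y} (_ : classL 𝒞 N s) {Z : C} (g : X ⟶ Z),
      ∃ (W : C) (s' : Z ⟶ W) (g' : Y ⟶ W), classS 𝒞 N s' ∧ s ≫ g' = g ≫ s' := by
    rintro X Y s ⟨D, y, ⟨δ, h⟩, hD⟩ Z g
    obtain ⟨B, x', y', h'⟩ := exists_triangle (𝒞.push g δ)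
    obtain ⟨b, hb, -, -⟩ := h𝒞.exists_good_lift_push g h h'
    exact ⟨B, x', b, .of_L _ ⟨D, y', ⟨_, h'⟩, hD⟩, hb⟩
  induction hs generalizing Z with
  | of_L f hf =>
    obtain ⟨W, s', g', h, h'⟩ := hL hf g
    exact ⟨W, s', g', h, by simpa [h'] using Factors.zero hN.zero_mem⟩
  | of_R f hf =>
    obtain ⟨M, l, hM, hl, rfl⟩ := hf.exists_classL h𝒞 hN
    obtain ⟨W, s', g', h, h'⟩ := hL hl g
    refine ⟨W, s', biprod.inl ≫ g', h, ?_⟩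
    rw [← h']
    -- Discarding the summand `M` costs exactly the component of `l ≫ g'` through `M`.
    have : (l ≫ biprod.fst) ≫ biprod.inl ≫ g' - l ≫ g' =
        -((l ≫ biprod.snd) ≫ biprod.inr ≫ g') := by
      have : l ≫ g' = l ≫ (biprod.fst ≫ biprod.inl + biprod.snd ≫ biprod.inr) ≫ g' := by simp
      rw [this]
      simp only [Preadditive.add_comp, Preadditive.comp_add, Category.assoc]
      abel
    rw [this]
    exact ((Factors.of_source hM _).precomp _).neg
  | comp f₁ f₂ _ _ ih₁ ih₂ =>
    obtain ⟨W₁, s₁, g₁, hs₁, h₁⟩ := ih₁ g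
    obtain ⟨W₂, s₂, g₂, hs₂, h₂⟩ := ih₂ g₁
    refine ⟨W₂, s₁ ≫ s₂, g₂, .comp _ _ hs₁ hs₂, ?_⟩
    have : (f₁ ≫ f₂) ≫ g₂ - g ≫ s₁ ≫ s₂ =
        f₁ ≫ (f₂ ≫ g₂ - g₁ ≫ s₂) + (f₁ ≫ g₁ - g ≫ s₁) ≫ s₂ := by
      simp [Preadditive.comp_sub, Preadditive.sub_comp]
    rw [this]
    exact (h₂.precomp _).add hN.biprod_mem (h₁.postcomp _)

lemma classS.exists_right_square (h𝒞 : 𝒞.IsExtriangulated) (hN : 𝒞.IsBiresolvingThick N) {X Y : C}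
    {s : X ⟶ Y} (hs : classS 𝒞 N s) {Z : C} (g : Z ⟶ Y) :
    ∃ (W : C) (s' : W ⟶ Z) (g' : W ⟶ X), classS 𝒞 N s' ∧ Factors N (g' ≫ s - s' ≫ g) := by
  obtain ⟨W, s', g', h, h'⟩ :=
    classS.exists_left_square h𝒞.op hN.op ((classS_op_iff s.op).2 hs) g.op
  exact ⟨unop W, s'.unop, g'.unop, (classS_op_iff _).1 h, (factors_op_iff _).1 h'⟩

/-- A morphism which is monic and epic modulo `N` belongs to `𝒮`. -/
lemma classS_of_monoMod_of_epiMod (h𝒞 : 𝒞.IsExtriangulated) (hN : 𝒞.IsBiresolvingThick N) {X Y : C}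
    {f : X ⟶ Y} (hm : MonoMod N f) (he : EpiMod N f) : classS 𝒞 N f := by
  obtain ⟨M, m, hM, hmd⟩ := hN.exists_deflation Y
  obtain ⟨K, k, κ, hκ⟩ := deflation_desc h𝒞.1 hmd f
  have hkf : (k ≫ biprod.fst) ≫ f = -((k ≫ biprod.snd) ≫ m) := by
    have := hκ.comp_eq_zero h𝒞.1
    rw [biprod.desc_eq, Preadditive.comp_add] at this
    simpa using eq_neg_of_add_eq_zero_left this
  have hk : Factors N k := by
    have : k = (k ≫ biprod.fst) ≫ biprod.inl + (k ≫ biprod.snd) ≫ biprod.inr := by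
      ext <;> simp
    rw [this]
    refine ((hm _ ?_).postcomp _).add hN.biprod_mem ((Factors.of_source hM _).precomp _)
    rw [hkf]
    exact ((Factors.of_source hM _).precomp _).neg
  obtain ⟨M₁, i₁, j₁, hM₁, hk⟩ := hk
  obtain ⟨M₂, i₂, hM₂, hi₂⟩ := hN.exists_inflation K
  -- `i₂` makes `i₁` into an inflation through which `k` still factors. Therefore `k_* ε = 0`, and
  -- this is the class of the triangle of `b`, which splits.
  obtain ⟨L, q, ε, hε⟩ := inflation_lift h𝒞.1 hi₂ i₁
  have hM₃ : N (M₂ ⊞ M₁) := hN.biprod_mem hM₂ hM₁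
  obtain ⟨B, x', r, hr⟩ := exists_triangle (𝒞.push (biprod.lift i₂ i₁) κ)
  obtain ⟨b, -, hbr, hb⟩ := h𝒞.exists_good_lift_push _ hκ hr
  obtain ⟨q', hq'⟩ := hε.of_good_lift_push h𝒞.1 hb
  have hz : 𝒞.push k ε = 0 := by
    rw [hk, show i₁ ≫ j₁ = biprod.lift i₂ i₁ ≫ biprod.snd ≫ j₁ by simp, push_comp,
      hε.push_ι h𝒞.1, push_zero]
  rw [hz] at hq'
  obtain ⟨-, σ, -, hσ, -, -⟩ := hq'.split h𝒞.1
  have hrS : classS 𝒞 N r := .of_R _ ⟨_, x', ⟨_, hr⟩, hM₃⟩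
  obtain ⟨W, s', g', hs', hsq⟩ := hrS.exists_left_square h𝒞 hN q'
  -- Complete `r` and `q'` to a square modulo `N`. Precomposing with `b` kills `q'`, so `f ≫ g'`
  -- factors through `N`; hence so do `g'`, as `f` is epic modulo `N`, then `q' ≫ s'`, and `s'` via
  -- the section `σ`. As `s'` is monic modulo `N`, so does `𝟙 L`.
  have hL : N L := by
    have h₁ : Factors N (biprod.desc f m ≫ g') := by
      rw [← hbr]
      have := hsq.precomp b
      rw [Preadditive.comp_sub, ← Category.assoc b q', hq'.comp_eq_zero h𝒞.1] at this
      simpa using this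
    have h₂ : Factors N (f ≫ g') := by simpa using h₁.precomp biprod.inl
    have h₃ : Factors N (q' ≫ s') := by
      have := ((he _ h₂).precomp r).sub hN.biprod_mem hsq
      simpa using this
    have h₄ : Factors N s' := by simpa [reassoc_of% hσ] using h₃.precomp σ
    exact hN.of_factors_id h𝒞.1 (hs'.monoMod h𝒞 hN _ (by simpa using h₄))
  have : f = biprod.inl ≫ b ≫ r := by simp [hbr]
  rw [this]
  exact .comp _ _ (.of_L _ (classL_inl h𝒞.1 X hM))
    (.comp _ _ (.of_L _ ⟨L, q', ⟨_, hq'⟩, hL⟩) hrS)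

/-! ### Two-out-of-three, lifts to middle terms, exchange with inflations -/

lemma classS_iff (h𝒞 : 𝒞.IsExtriangulated) (hN : 𝒞.IsBiresolvingThick N) {X Y : C} (f : X ⟶ Y) :
    classS 𝒞 N f ↔ MonoMod N f ∧ EpiMod N f :=
  ⟨fun h => ⟨h.monoMod h𝒞 hN, h.epiMod h𝒞 hN⟩,
    fun h => classS_of_monoMod_of_epiMod h𝒞 hN h.1 h.2⟩

/-- Only monicity of `g` modulo `N` is not formal: a test map `h` into `Y` is first moved along `f`
by a square over some `s ∈ 𝒮`, and `s` is cancelled at the end as an epimorphism modulo `N`. -/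
lemma classS.of_precomp (h𝒞 : 𝒞.IsExtriangulated) (hN : 𝒞.IsBiresolvingThick N) {X Y Z : C}
    {f : X ⟶ Y} {g : Y ⟶ Z} (hf : classS 𝒞 N f) (hfg : classS 𝒞 N (f ≫ g)) : classS 𝒞 N g := by
  refine classS_of_monoMod_of_epiMod h𝒞 hN ?_ ?_
  · intro W h hh
    obtain ⟨W', s, h', hs, hsq⟩ := hf.exists_right_square h𝒞 hN h
    have h₁ : Factors N (h' ≫ f ≫ g) := by
      have := (hsq.postcomp g).add hN.biprod_mem (hh.precomp s)
      simpa [Preadditive.sub_comp] using this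
    have h₂ := (hfg.monoMod h𝒞 hN _ h₁).postcomp f
    refine hs.epiMod h𝒞 hN _ ?_
    simpa using h₂.sub hN.biprod_mem hsq
  · intro W h hh
    refine hfg.epiMod h𝒞 hN _ ?_
    simpa using hh.precomp f

lemma classS.of_postcomp (h𝒞 : 𝒞.IsExtriangulated) (hN : 𝒞.IsBiresolvingThick N) {X Y Z : C}
    {f : X ⟶ Y} {g : Y ⟶ Z} (hg : classS 𝒞 N g) (hfg : classS 𝒞 N (f ≫ g)) : classS 𝒞 N f :=
  (classS_op_iff f.op).1 (classS.of_precomp h𝒞.op hN.op ((classS_op_iff g.op).2 hg)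
    ((classS_op_iff (g.op ≫ f.op)).2 hfg))

/-- Morphisms of extensions whose first component is in `𝒮` and whose second component is the
identity lift to the middle terms by a morphism in `𝒮`. -/
lemma classS.exists_push_lift (h𝒞 : 𝒞.IsExtriangulated) {A A' : C} {a : A ⟶ A'}
    (ha : classS 𝒞 N a) {B B' D : C} {x : A ⟶ B} {y : B ⟶ D} {δ : 𝒞.Ext D A}
    (h : 𝒞.IsTriangle x y δ) {x' : A' ⟶ B'} {y' : B' ⟶ D}
    (h' : 𝒞.IsTriangle x' y' (𝒞.push a δ)) :
    ∃ b : B ⟶ B', classS 𝒞 N b ∧ x ≫ b = a ≫ x' ∧ b ≫ y' = y := by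
  induction ha generalizing B B' with
  | of_L f hf =>
    obtain ⟨V, q, ⟨ν, hν⟩, hV⟩ := hf
    obtain ⟨b, hb₁, hb₂, hb⟩ := h𝒞.exists_good_lift_push _ h h'
    obtain ⟨y'', hy⟩ := hν.of_good_lift_push h𝒞.1 hb
    exact ⟨b, .of_L _ ⟨V, y'', ⟨_, hy⟩, hV⟩, hb₁, hb₂⟩
  | of_R f hf =>
    obtain ⟨M, m, ⟨μ, hμ⟩, hM⟩ := hf
    obtain ⟨b, hb₁, hb₂, hb⟩ := h𝒞.exists_good_lift_push _ h h'
    exact ⟨b, .of_R _ ⟨M, _, h.of_good_lift_push' h𝒞.1 h𝒞.inflations_comp hμ hb, hM⟩, hb₁, hb₂⟩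
  | comp a₁ a₂ _ _ ih₁ ih₂ =>
    rw [push_comp] at h'
    obtain ⟨B₁, x₁, y₁, h₁⟩ := exists_triangle (𝒞.push a₁ δ)
    obtain ⟨b₁, hb₁, hx₁, hy₁⟩ := ih₁ h h₁
    obtain ⟨b₂, hb₂, hx₂, hy₂⟩ := ih₂ h₁ h'
    exact ⟨b₁ ≫ b₂, .comp _ _ hb₁ hb₂, by rw [reassoc_of% hx₁, hx₂, Category.assoc],
      by rw [Category.assoc, hy₂, hy₁]⟩

lemma classS.exists_pull_lift (h𝒞 : 𝒞.IsExtriangulated) {D D' : C} {c : D' ⟶ D}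
    (hc : classS 𝒞 N c) {A B B' : C} {x : A ⟶ B} {y : B ⟶ D} {δ : 𝒞.Ext D A}
    (h : 𝒞.IsTriangle x y δ) {x' : A ⟶ B'} {y' : B' ⟶ D'}
    (h' : 𝒞.IsTriangle x' y' (𝒞.pull c δ)) :
    ∃ b : B' ⟶ B, classS 𝒞 N b ∧ x' ≫ b = x ∧ b ≫ y = y' ≫ c := by
  obtain ⟨b, hb, h₁, h₂⟩ := classS.exists_push_lift h𝒞.op ((classS_op_iff c.op).2 hc)
    (isTriangle_op h) (x' := y'.op) (y' := x'.op) ((isTriangle_op_iff _ _ _).2 h')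
  exact ⟨b.unop, (classS_op_iff _).1 hb, congrArg Quiver.Hom.unop h₂, congrArg Quiver.Hom.unop h₁⟩

/-- The morphism of extensions factors through a realization of `a_* δ = c^* δ'`, one end term being
fixed at each stage. -/
lemma classS.exists_lift (h𝒞 : 𝒞.IsExtriangulated) {A B D A' B' D' : C} {x : A ⟶ B} {y : B ⟶ D}
    {δ : 𝒞.Ext D A} {x' : A' ⟶ B'} {y' : B' ⟶ D'} {δ' : 𝒞.Ext D' A'} {a : A ⟶ A'} {c : D ⟶ D'}
    (h : 𝒞.IsTriangle x y δ) (h' : 𝒞.IsTriangle x' y' δ') (hac : 𝒞.push a δ = 𝒞.pull c δ')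
    (ha : classS 𝒞 N a) (hc : classS 𝒞 N c) :
    ∃ b : B ⟶ B', classS 𝒞 N b ∧ x ≫ b = a ≫ x' ∧ y ≫ c = b ≫ y' := by
  obtain ⟨B₁, x₁, y₁, h₁⟩ := exists_triangle (𝒞.push a δ)
  obtain ⟨b₁, hb₁, hx₁, hy₁⟩ := ha.exists_push_lift h𝒞 h h₁
  rw [hac] at h₁
  obtain ⟨b₂, hb₂, hx₂, hy₂⟩ := hc.exists_pull_lift h𝒞 h' h₁
  exact ⟨b₁ ≫ b₂, .comp _ _ hb₁ hb₂, by rw [reassoc_of% hx₁, hx₂],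
    by rw [Category.assoc, hy₂, reassoc_of% hy₁]⟩

/-- An inflation can be moved to the left past a morphism of `𝒮`. -/
lemma classS.exists_inflation_comp (h𝒞 : 𝒞.IsExtriangulated) (hN : 𝒞.IsBiresolvingThick N)
    {A A' B : C} {s : A ⟶ A'} (hs : classS 𝒞 N s) {x : A' ⟶ B} (hx : 𝒞.inflations x) :
    ∃ (Z : C) (x₁ : A ⟶ Z) (s₁ : Z ⟶ B), 𝒞.inflations x₁ ∧ classS 𝒞 N s₁ ∧ s ≫ x = x₁ ≫ s₁ := by
  induction hs generalizing B with
  | of_L f hf =>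
    obtain ⟨D, y, hy, -⟩ := hf
    exact ⟨B, f ≫ x, 𝟙 B, h𝒞.inflations_comp.comp_mem _ _ ⟨D, y, hy⟩ hx,
      .of_L _ ⟨0, 0, ⟨0, h𝒞.triangle_id_zero B⟩, hN.zero_mem⟩, by simp⟩
  | @of_R X Y f hf =>
    -- After writing `f` as the inflation `l` followed by a projection, only the projection has to
    -- be exchanged with `x`. Since it retracts `biprod.inl`, it pushes `biprod.inl_* δ` back to
    -- `δ`.
    obtain ⟨M, l, hM, ⟨T, t, hl, -⟩, rfl⟩ := hf.exists_classL h𝒞 hN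
    obtain ⟨D, y, δ, h⟩ := hx
    obtain ⟨B', x', y', h'⟩ := exists_triangle (𝒞.push (biprod.inl : Y ⟶ Y ⊞ M) δ)
    obtain ⟨b, hb, hb', -⟩ := classS.exists_push_lift h𝒞
      (.of_R _ (classR_fst h𝒞.1 Y hM)) h' (x' := x) (y' := y)
      (by rw [← push_comp, biprod.inl_fst, push_id]; exact h)
    exact ⟨B', l ≫ x', b, h𝒞.inflations_comp.comp_mem _ _ ⟨T, t, hl⟩ ⟨_, _, _, h'⟩, hb,
      by simp [hb']⟩
  | comp f g _ _ ihf ihg =>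
    obtain ⟨Z₁, x₁, s₁, hx₁, hs₁, e₁⟩ := ihg hx
    obtain ⟨Z₂, x₂, s₂, hx₂, hs₂, e₂⟩ := ihf hx₁
    exact ⟨Z₂, x₂, s₂ ≫ s₁, hx₂, .comp _ _ hs₂ hs₁, by rw [Category.assoc, e₁, reassoc_of% e₂]⟩

/-- A deflation can be moved to the right past a morphism of `𝒮`. -/
lemma classS.exists_comp_deflation (h𝒞 : 𝒞.IsExtriangulated) (hN : 𝒞.IsBiresolvingThick N)
    {B D D' : C} {y : B ⟶ D} (hy : 𝒞.deflations y) {s : D ⟶ D'} (hs : classS 𝒞 N s) :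
    ∃ (Z : C) (s₁ : B ⟶ Z) (y₁ : Z ⟶ D'), classS 𝒞 N s₁ ∧ 𝒞.deflations y₁ ∧ y ≫ s = s₁ ≫ y₁ := by
  obtain ⟨Z, x₁, s₁, hx₁, hs₁, e⟩ := classS.exists_inflation_comp h𝒞.op hN.op
    ((classS_op_iff s.op).2 hs) ((inflations_op_iff y.op).2 hy)
  exact ⟨unop Z, s₁.unop, x₁.unop, (classS_op_iff _).1 hs₁, (inflations_op_iff _).1 hx₁,
    congrArg Quiver.Hom.unop e⟩

end

/-! ### Passage to the ideal quotient -/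

section

variable [Preadditive C] [HasZeroObject C]

lemma exists_barProj_map {S : MorphismProperty C} {X Y : C}
    (φ : (barProj S).obj X ⟶ (barProj S).obj Y) : ∃ f : X ⟶ Y, (barProj S).map f = φ :=
  (barProj S).map_surjective φ

variable [HasBinaryBiproducts C]

/-- Ensures that two morphisms become equal in the quotient only if they are related by `idealRel`
itself, with no further closure of the relation. -/
lemma congruence_idealRel {N : ObjectProperty C} (h0 : N 0)
    (hN : ∀ {X Y : C}, N X → N Y → N (X ⊞ Y)) : Congruence (idealRel N) where
  comp_left f g g' h := by
    have : Factors N (f ≫ (g - g')) := Factors.precomp h f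
    rwa [Preadditive.comp_sub] at this
  comp_right g h := by
    have := Factors.postcomp h g
    rwa [Preadditive.sub_comp] at this
  equivalence :=
    { refl := fun f => by
        change Factors N (f - f)
        simpa using Factors.zero h0
      symm := fun {f g} h => by
        change Factors N (g - f)
        simpa using Factors.neg h
      trans := fun {f g k} h h' => by
        change Factors N (f - k)
        simpa using Factors.add hN h h' }

variable {𝒞 : Data.{v, u, w} C} {N : ObjectProperty C}

lemma barProj_map_eq_iff (h𝒞 : 𝒞.IsExtriangulated) (hN : 𝒞.IsBiresolvingThick N) {X Y : C}
    (f g : X ⟶ Y) : (barProj (classS 𝒞 N)).map f = (barProj (classS 𝒞 N)).map g ↔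
      Factors N (f - g) := by
  have h := nullObjects_classS h𝒞 hN
  have : Congruence (idealRel (nullObjects (classS 𝒞 N))) := by
    rw [h]
    exact congruence_idealRel hN.zero_mem hN.biprod_mem
  rw [CategoryTheory.Quotient.functor_map_eq_iff]
  change Factors (nullObjects (classS 𝒞 N)) (f - g) ↔ _
  rw [h]

lemma mono_barProj_map_iff (h𝒞 : 𝒞.IsExtriangulated) (hN : 𝒞.IsBiresolvingThick N) {X Y : C}
    (f : X ⟶ Y) : Mono ((barProj (classS 𝒞 N)).map f) ↔ MonoMod N f := by
  constructor
  · intro h W g hg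
    have : (barProj (classS 𝒞 N)).map g = (barProj (classS 𝒞 N)).map 0 := by
      rw [← cancel_mono ((barProj (classS 𝒞 N)).map f), ← Functor.map_comp, ← Functor.map_comp,
        barProj_map_eq_iff h𝒞 hN]
      simpa using hg
    simpa using (barProj_map_eq_iff h𝒞 hN _ _).1 this
  · intro h
    constructor
    rintro ⟨W⟩ g k hgk
    obtain ⟨g, rfl⟩ := exists_barProj_map (X := W) g
    obtain ⟨k, rfl⟩ := exists_barProj_map (X := W) k
    rw [← Functor.map_comp, ← Functor.map_comp, barProj_map_eq_iff h𝒞 hN,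
      ← Preadditive.sub_comp] at hgk
    exact (barProj_map_eq_iff h𝒞 hN _ _).2 (h _ hgk)

lemma epi_barProj_map_iff (h𝒞 : 𝒞.IsExtriangulated) (hN : 𝒞.IsBiresolvingThick N) {X Y : C}
    (f : X ⟶ Y) : Epi ((barProj (classS 𝒞 N)).map f) ↔ EpiMod N f := by
  constructor
  · intro h W g hg
    have : (barProj (classS 𝒞 N)).map g = (barProj (classS 𝒞 N)).map 0 := by
      rw [← cancel_epi ((barProj (classS 𝒞 N)).map f), ← Functor.map_comp, ← Functor.map_comp,
        barProj_map_eq_iff h𝒞 hN]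
      simpa using hg
    simpa using (barProj_map_eq_iff h𝒞 hN _ _).1 this
  · intro h
    constructor
    rintro ⟨W⟩ g k hgk
    obtain ⟨g, rfl⟩ := exists_barProj_map (Y := W) g
    obtain ⟨k, rfl⟩ := exists_barProj_map (Y := W) k
    rw [← Functor.map_comp, ← Functor.map_comp, barProj_map_eq_iff h𝒞 hN,
      ← Preadditive.comp_sub] at hgk
    exact (barProj_map_eq_iff h𝒞 hN _ _).2 (h _ hgk)

lemma barClass_eq (h𝒞 : 𝒞.IsExtriangulated) (hN : 𝒞.IsBiresolvingThick N) :
    barClass (classS 𝒞 N) = MorphismProperty.monomorphisms (Bar (classS 𝒞 N)) ⊓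
      MorphismProperty.epimorphisms (Bar (classS 𝒞 N)) := by
  apply le_antisymm
  · rintro X Y φ ⟨X', Y', f, hf, ⟨e⟩⟩
    refine ((MorphismProperty.monomorphisms _ ⊓ MorphismProperty.epimorphisms _).arrow_mk_iso_iff
      e).1 ⟨?_, ?_⟩
    · exact (mono_barProj_map_iff h𝒞 hN f).2 (hf.monoMod h𝒞 hN)
    · exact (epi_barProj_map_iff h𝒞 hN f).2 (hf.epiMod h𝒞 hN)
  · rintro ⟨X⟩ ⟨Y⟩ φ ⟨hm, he⟩
    obtain ⟨f, rfl⟩ := exists_barProj_map (X := X) (Y := Y) φ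
    exact MorphismProperty.map_mem_map _ _ _ (classS_of_monoMod_of_epiMod h𝒞 hN
      ((mono_barProj_map_iff h𝒞 hN f).1 hm) ((epi_barProj_map_iff h𝒞 hN f).1 he))

/-- Saturation: closing `p(𝒮)` under isomorphisms of the quotient and lifting back to `C` adds
nothing to `𝒮`, since being monic and epic is invariant under isomorphism. -/
lemma barClass_map_iff (h𝒞 : 𝒞.IsExtriangulated) (hN : 𝒞.IsBiresolvingThick N) {X Y : C}
    (f : X ⟶ Y) :
    barClass (classS 𝒞 N) ((barProj (classS 𝒞 N)).map f) ↔ classS 𝒞 N f := by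
  rw [barClass_eq h𝒞 hN, classS_iff h𝒞 hN, ← mono_barProj_map_iff h𝒞 hN,
    ← epi_barProj_map_iff h𝒞 hN]
  rfl

lemma barClass_comp (h𝒞 : 𝒞.IsExtriangulated) (hN : 𝒞.IsBiresolvingThick N) :
    (barClass (classS 𝒞 N)).IsStableUnderComposition := by
  rw [barClass_eq h𝒞 hN]
  infer_instance

lemma barClass_isMultiplicative (h𝒞 : 𝒞.IsExtriangulated) (hN : 𝒞.IsBiresolvingThick N) :
    (barClass (classS 𝒞 N)).IsMultiplicative := by
  rw [barClass_eq h𝒞 hN]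
  infer_instance

lemma mr1 (h𝒞 : 𝒞.IsExtriangulated) (hN : 𝒞.IsBiresolvingThick N) : MR1 (classS 𝒞 N) where
  toIsStableUnderComposition := barClass_comp h𝒞 hN
  of_postcomp := by
    rintro ⟨X⟩ ⟨Y⟩ ⟨Z⟩ f g hg hfg
    obtain ⟨f, rfl⟩ := exists_barProj_map (X := X) (Y := Y) f
    obtain ⟨g, rfl⟩ := exists_barProj_map (X := Y) (Y := Z) g
    rw [← Functor.map_comp] at hfg
    rw [barClass_map_iff h𝒞 hN] at *
    exact hg.of_postcomp h𝒞 hN hfg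
  of_precomp := by
    rintro ⟨X⟩ ⟨Y⟩ ⟨Z⟩ f g hf hfg
    obtain ⟨f, rfl⟩ := exists_barProj_map (X := X) (Y := Y) f
    obtain ⟨g, rfl⟩ := exists_barProj_map (X := Y) (Y := Z) g
    rw [← Functor.map_comp] at hfg
    rw [barClass_map_iff h𝒞 hN] at *
    exact hf.of_precomp h𝒞 hN hfg

lemma mr2 (h𝒞 : 𝒞.IsExtriangulated) (hN : 𝒞.IsBiresolvingThick N) : MR2 (classS 𝒞 N) := by
  have hmul := barClass_isMultiplicative h𝒞 hN
  constructor
  · refine { hmul with exists_leftFraction := ?_, ext := ?_ }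
    · rintro ⟨X⟩ ⟨Y⟩ @⟨⟨X'⟩, s, hs, f⟩
      obtain ⟨s, rfl⟩ := exists_barProj_map (X := X') (Y := X) s
      obtain ⟨f, rfl⟩ := exists_barProj_map (X := X') (Y := Y) f
      obtain ⟨W, s', g', hs', hsq⟩ :=
        ((barClass_map_iff h𝒞 hN _).1 hs).exists_left_square h𝒞 hN f
      refine ⟨⟨(barProj _).map g', (barProj _).map s', (barClass_map_iff h𝒞 hN _).2 hs'⟩, ?_⟩
      have := (barProj_map_eq_iff h𝒞 hN _ _).2 hsq
      simpa using this.symm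
    · intro X' X Y f₁ f₂ s hs h
      rw [barClass_eq h𝒞 hN] at hs
      have : Epi s := hs.2
      -- Members of `𝒮̄` are epic, so the two maps are already equal and the identity equalizes
      -- them.
      exact ⟨Y, 𝟙 Y, hmul.id_mem Y, by rw [cancel_epi] at h; simp [h]⟩
  · refine { hmul with exists_rightFraction := ?_, ext := ?_ }
    · rintro ⟨X⟩ ⟨Y⟩ @⟨⟨Y'⟩, f, s, hs⟩
      obtain ⟨s, rfl⟩ := exists_barProj_map (X := Y) (Y := Y') s
      obtain ⟨f, rfl⟩ := exists_barProj_map (X := X) (Y := Y') f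
      obtain ⟨W, s', g', hs', hsq⟩ :=
        ((barClass_map_iff h𝒞 hN _).1 hs).exists_right_square h𝒞 hN f
      refine ⟨⟨(barProj _).map s', (barClass_map_iff h𝒞 hN _).2 hs', (barProj _).map g'⟩, ?_⟩
      have := (barProj_map_eq_iff h𝒞 hN _ _).2 hsq
      simpa using this.symm
    · intro X Y Y' f₁ f₂ s hs h
      rw [barClass_eq h𝒞 hN] at hs
      have : Mono s := hs.1
      exact ⟨X, 𝟙 X, hmul.id_mem X, by rw [cancel_mono] at h; simp [h]⟩

lemma mr3 (h𝒞 : 𝒞.IsExtriangulated) (hN : 𝒞.IsBiresolvingThick N) : MR3 𝒞 (classS 𝒞 N) := by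
  intro A B D A' B' D' x y δ x' y' δ' a c h h' hac ha hc
  rw [barClass_map_iff h𝒞 hN] at ha hc
  obtain ⟨b, hb, h₁, h₂⟩ := classS.exists_lift h𝒞 h h' hac ha hc
  exact ⟨(barProj _).map b, (barClass_map_iff h𝒞 hN _).2 hb,
    by rw [← Functor.map_comp, h₁, Functor.map_comp],
    by rw [← Functor.map_comp, h₂, Functor.map_comp]⟩

lemma mr4 (h𝒞 : 𝒞.IsExtriangulated) (hN : 𝒞.IsBiresolvingThick N) : MR4 𝒞 (classS 𝒞 N) := by
  have hcomp := barClass_comp h𝒞 hN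
  constructor
  · constructor
    rintro X Y Z _ _ ⟨A, B, x, u, v, hx, hu, hv, rfl⟩ ⟨A', B', x', u', v', hx', hu', hv', rfl⟩
    -- The middle factor `v ≫ u'` lifts to some `s ∈ 𝒮` by fullness and saturation; exchanging `s`
    -- with `x'` in `C` brings the two inflations together.
    obtain ⟨s, hs⟩ := exists_barProj_map (v ≫ u')
    have hsS : classS 𝒞 N s := by
      rw [← barClass_map_iff h𝒞 hN, hs]
      exact hcomp.comp_mem _ _ hv hu'
    obtain ⟨W, x₁, s₁, hx₁, hs₁, e⟩ := hsS.exists_inflation_comp h𝒞 hN hx'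
    refine ⟨A, W, x ≫ x₁, u, (barProj _).map s₁ ≫ v', h𝒞.inflations_comp.comp_mem _ _ hx hx₁, hu,
      hcomp.comp_mem _ _ ((barClass_map_iff h𝒞 hN _).2 hs₁) hv', ?_⟩
    have e' := congrArg (barProj (classS 𝒞 N)).map e
    rw [Functor.map_comp, Functor.map_comp, hs, Category.assoc] at e'
    simp only [Category.assoc, Functor.map_comp]
    rw [reassoc_of% e']
  · constructor
    rintro X Y Z _ _ ⟨A, B, y, u, v, hy, hu, hv, rfl⟩ ⟨A', B', y', u', v', hy', hu', hv', rfl⟩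
    obtain ⟨s, hs⟩ := exists_barProj_map (v ≫ u')
    have hsS : classS 𝒞 N s := by
      rw [← barClass_map_iff h𝒞 hN, hs]
      exact hcomp.comp_mem _ _ hv hu'
    obtain ⟨W, s₁, y₁, hs₁, hy₁, e⟩ := hsS.exists_comp_deflation h𝒞 hN hy
    refine ⟨W, B', y₁ ≫ y', u ≫ (barProj _).map s₁, v', h𝒞.deflations_comp.comp_mem _ _ hy₁ hy',
      hcomp.comp_mem _ _ hu ((barClass_map_iff h𝒞 hN _).2 hs₁), hv', ?_⟩
    have e' := congrArg (barProj (classS 𝒞 N)).map e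
    rw [Functor.map_comp, Functor.map_comp, hs] at e'
    simp only [Category.assoc, Functor.map_comp] at e' ⊢
    rw [reassoc_of% e']

end

end Extri

theorem proposition4p22 {C : Type u} [Category.{v} C] [Preadditive C] [HasZeroObject C]
    [HasBinaryBiproducts C] (𝒞 : Extri.Data.{v, u, w} C) (h𝒞 : 𝒞.IsExtriangulated)
    (N : ObjectProperty C) (hN : 𝒞.IsBiresolvingThick N) :
    Extri.nullObjects (Extri.classS 𝒞 N) = N ∧
    Extri.MR1 (Extri.classS 𝒞 N) ∧
    Extri.MR2 (Extri.classS 𝒞 N) ∧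
    Extri.MR3 𝒞 (Extri.classS 𝒞 N) ∧
    Extri.MR4 𝒞 (Extri.classS 𝒞 N) ∧
    Extri.barClass (Extri.classS 𝒞 N) =
      MorphismProperty.monomorphisms (Extri.Bar (Extri.classS 𝒞 N)) ⊓
        MorphismProperty.epimorphisms (Extri.Bar (Extri.classS 𝒞 N)) :=
  ⟨Extri.nullObjects_classS h𝒞 hN, Extri.mr1 h𝒞 hN, Extri.mr2 h𝒞 hN, Extri.mr3 h𝒞 hN,
    Extri.mr4 h𝒞 hN, Extri.barClass_eq h𝒞 hN⟩
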